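/- **Setting.** Let $k$ be a field, $S=k[x_1,\dots,x_n]$, and let $M\subsetneq S$ be a proper monomial ideal minimally generated by monomials $m_1,\dots,m_r$. Let $L_M$ be the lcm-lattice of $M$ (all lcms of subsets of $\{m_1,\dots,m_r\}$, ordered by divisibility, with bottom element $1$). For $m\in L_M$ put $A_m=\{i : m_i \text{ divides } m\}$. For $1\ne m\in L_M$ let $\Delta_m=\langle A_\beta : \beta \text{ covered by } m \text{ in } L_M\rangle$ be the simplicial complex generated by these sets (so $\Delta_{m_j}=\{\emptyset\}$), and let $\widetilde H_i(\Delta_m;k)$ be reduced simplicial homology. The Betti poset $B_M$ consists of $1$ and of all $1\neq m\in L_M$ with $\widetilde H(\Delta_m;k)\ne0$. The ideal $M$ is *rigid* if (i) whenever $1<m'<m$ in $L_M$, $\widetilde H_i(\Delta_{m'};k)\neq0$ and $\widetilde H_j(\Delta_m;k)\ne0$, then $i<j$; and (ii) for every $1\neq m\in B_M$ the total reduced homology $\widetilde H(\Delta_m;k)=\bigoplus_i\widetilde H_i(\Delta_m;k)$ is isomorphic to $k$. **The poset construction $\mathcal D(L_M)$.** Let $\mathcal D_0=\widetilde H_{-1}(\{\emptyset\};k)\cong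 k$ and $\mathcal D_i=\bigoplus_{1\ne m\in L_M}\widetilde H_{i-2}(\Delta_m;k)$ for $i\ge1$. The map $\varphi_1:\mathcal D_1=\bigoplus_j\widetilde H_{-1}(\Delta_{m_j};k)\to\mathcal D_0$ is the identity of $\widetilde H_{-1}(\{\emptyset\};k)$ on each summand. Let $i\ge2$ and $1\neq m\in L_M$. Let $\beta_1,\dots,\beta_l$ be the maximal elements of $\{\beta\in B_M:\beta<m\}$ and $\widetilde\Delta_m=\langle A_{\beta_1},\dots,A_{\beta_l}\rangle\subseteq\Delta_m$; the inclusion induces an isomorphism $\sigma_m:\widetilde H(\widetilde\Delta_m;k)\to\widetilde H(\Delta_m;k)$. For each $j$ let $\Delta_1=\langle A_{\beta_j}\rangle$ and $\Delta_2=\langle A_{\beta_s}:s\ne j\rangle$. Then $\Delta_1\cup\Delta_2=\widetilde\Delta_m$ and $\Delta_1\cap\Delta_2\subseteq\Delta_{\beta_j}$. Let $\delta$ be the Mayer–Vietoris connecting map $\widetilde H_{i-2}(\widetilde\Delta_m;k)\to\widetilde H_{i-3}(\Delta_1\cap\Delta_2;k)$, $[c_1-c_2]\mapsto[d c_1]$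 for chains $c_s$ of $\Delta_s$, let $\iota:\widetilde H_{i-3}(\Delta_1\cap\Delta_2;k)\to\widetilde H_{i-3}(\Delta_{\beta_j};k)$ be induced by inclusion, and put $\varphi_{i,m}^{\beta_j}=\iota\circ\delta\circ\sigma_m^{-1}$. The map $\varphi_i:\mathcal D_i\to\mathcal D_{i-1}$ is $\sum_j\varphi_{i,m}^{\beta_j}$ on the summand $\widetilde H_{i-2}(\Delta_m;k)$. Fix any basis of every $\widetilde H_{i}(\Delta_m;k)$, taking the class $[\emptyset]$ as basis element of $\widetilde H_{-1}(\Delta_{m_j};k)$, and also of $\mathcal D_0$. This gives a basis of every $\mathcal D_i$. **The sequence $\mathcal F(L_M)$.** Let $\mathcal F_i=\mathcal D_i\otimes_k S$ with the induced basis, where the basis element of $\mathcal F_0$ has multidegree $1$ and basis elements from $\widetilde H_{i-2}(\Delta_m;k)$ have multidegree $m$. Let $\partial_1$ be given by the matrix $(m_1\ \cdots\ m_r)$, and for $i\geq 2$ let $\partial_i:\mathcal F_i\to\mathcal F_{i-1}$ have components $\frac{m}{\beta_j}\otimes\varphi_{i,m}^{\beta_j}$. **Frames and homogenization.** An *$r$-frame*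 is a finite complex $U$ of finite-dimensional $k$-vector spaces with fixed bases, concentrated in degrees $\ge0$, with $U_0=k$, $U_1=k^r$, whose differential sends every basis element of $U_1$ to $1$. Its *$M$-homogenization* is the sequence of multigraded free $S$-modules with the same basis elements and with multidegrees and differentials defined inductively as follows: the basis element in degree $0$ has multidegree $1$; the $j$-th basis element in degree $1$ has multidegree $m_j$; if $v$ is a basis element in degree $\geq 2$ with $d(v)=\sum_s\alpha_su_s$ in $U$, then $\mathrm{mdeg}(v)=\mathrm{lcm}(\mathrm{mdeg}(u_s):\alpha_s\ne0)$; and in every degree $\geq 1$, $d(v)=\sum_s\alpha_s\frac{\mathrm{mdeg}(v)}{\mathrm{mdeg}(u_s)}u_s$. Two sequences of multigraded free modules with fixed multigraded bases are *equal* if there is a multigraded isomorphism between them that maps the fixed bases bijectively onto each other. **Theorem.** If $M$ is rigid then, for every choice of bases as above, $\mathcal D(L_M)$ is an $r$-frame (the $j$-th basis element of $\mathcal D_1$ being the one from $\widetilde H_{-1}(\Delta_{m_j};k)$), $\mathcal F(L_M)$ equals the $M$-homogenization of $\mathcal D(L_M)$, and $\mathcal F(L_M)$ is a minimal (multigraded)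 free resolution of $S/M$. -/

import Mathlib

open scoped DirectSum TensorProduct

noncomputable section

namespace MonomialResolution

universe u

/-! ### Simplicial complexes on `{0, …, r-1}` and reduced simplicial homology

A simplicial complex is a lower set of faces; the empty face is a face of every nonvoid complex. -/

abbrev Complex (r : ℕ) := LowerSet (Finset (Fin r))

/-- The complex `⟨A₁, …, A_t⟩` whose faces are the subsets of the given sets. -/
abbrev generated {r : ℕ} (s : Set (Finset (Fin r))) : Complex r := lowerClosure s

/-- The complex `{∅}`. -/
abbrev pointComplex (r : ℕ) : Complex r := generated {∅}

/-- Chains of the full simplex, in all dimensions together: a chain is given by its coefficients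
at the faces, the empty face included. -/
abbrev Chain (k : Type u) (r : ℕ) := Finset (Fin r) → k

section Homology

variable (k : Type u) [Field k] {r : ℕ}

/-- The (augmented) simplicial boundary map of the full simplex, which sends a face
`{i₀ < … < i_p}` to `∑ j, (-1)^j {i₀, …, i_p} \ {i_j}`; see `boundary_single`. The faces with
`B` in their boundary are the `insert i B` with `i ∉ B`. -/
def boundary : Chain k r →ₗ[k] Chain k r where
  toFun c := fun B => ∑ i ∈ Bᶜ, (-1 : k) ^ (B.filter (· < i)).card * c (insert i B)
  map_add' c c' := by
    ext B
    simp [mul_add, Finset.sum_add_distrib]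
  map_smul' a c := by
    ext B
    simp [Finset.mul_sum, mul_left_comm]

theorem boundary_apply (c : Chain k r) (B : Finset (Fin r)) :
    boundary k c B = ∑ i ∈ Bᶜ, (-1 : k) ^ (B.filter (· < i)).card * c (insert i B) := rfl

theorem boundary_single (A : Finset (Fin r)) :
    boundary k (Pi.single A (1 : k)) =
      ∑ i ∈ A, Pi.single (A.erase i) ((-1 : k) ^ (A.filter (· < i)).card) := by
  ext B
  rw [boundary_apply, Finset.sum_apply]
  have h1 : ∀ i ∈ Bᶜ, (-1 : k) ^ (B.filter (· < i)).card * (Pi.single A (1 : k) : Chain k r)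
      (insert i B) = if i ∈ A ∧ A.erase i = B then (-1 : k) ^ (A.filter (· < i)).card else 0 := by
    intro i hi
    rw [Finset.mem_compl] at hi
    rw [Pi.single_apply]
    by_cases h : insert i B = A
    · subst h
      rw [if_pos rfl, mul_one, if_pos ⟨Finset.mem_insert_self _ _, Finset.erase_insert hi⟩,
        Finset.filter_insert, if_neg (lt_irrefl i)]
    · rw [if_neg h, mul_zero, if_neg]
      rintro ⟨h2, rfl⟩
      exact h (Finset.insert_erase h2)
  have h2 : ∀ i ∈ A, (Pi.single (A.erase i) ((-1 : k) ^ (A.filter (· < i)).card) : Chain k r) B =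
      if i ∈ Bᶜ ∧ A.erase i = B then (-1 : k) ^ (A.filter (· < i)).card else 0 := by
    intro i hi
    rw [Pi.single_apply]
    by_cases h : A.erase i = B
    · subst h
      simp
    · rw [if_neg (fun h' => h h'.symm), if_neg (fun h' => h h'.2)]
  rw [Finset.sum_congr rfl h1, Finset.sum_congr rfl h2, ← Finset.sum_filter, ← Finset.sum_filter]
  refine Finset.sum_congr ?_ fun _ _ => rfl
  ext i
  simp only [Finset.mem_filter]
  tauto

theorem boundary_boundary (c : Chain k r) : boundary k (boundary k c) = 0 := by
  ext B
  simp only [boundary_apply, Finset.mul_sum, Pi.zero_apply]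
  rw [Finset.sum_sigma']
  refine Finset.sum_involution (fun x _ => ⟨x.2, x.1⟩) ?_ ?_ ?_ ?_
  · rintro ⟨i, j⟩ h
    simp only [Finset.mem_sigma, Finset.mem_compl, Finset.mem_insert, not_or] at h
    obtain ⟨hi, hji, hj⟩ := h
    dsimp only
    rw [Finset.insert_comm i j, ← mul_assoc, ← mul_assoc, ← add_mul]
    have key : ∀ a b : Fin r, a ∉ B → b ∉ B → a < b →
        (-1 : k) ^ (B.filter (· < a)).card * (-1) ^ ((insert a B).filter (· < b)).card +
          (-1) ^ (B.filter (· < b)).card * (-1) ^ ((insert b B).filter (· < a)).card = 0 := by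
      intro a b ha hb hab
      rw [Finset.filter_insert, if_pos hab, Finset.filter_insert, if_neg hab.asymm,
        Finset.card_insert_of_notMem (by simp [ha]), pow_succ]
      ring
    rcases lt_or_gt_of_ne hji with h | h
    · rw [add_comm, key j i hj hi h, zero_mul]
    · rw [key i j hi hj h, zero_mul]
  · rintro ⟨i, j⟩ h _ h'
    simp only [Finset.mem_sigma, Finset.mem_compl, Finset.mem_insert, not_or] at h
    exact h.2.1 (congrArg Sigma.fst h')
  · rintro ⟨i, j⟩ h
    simp only [Finset.mem_sigma, Finset.mem_compl, Finset.mem_insert, not_or] at h ⊢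
    exact ⟨h.2.2, Ne.symm h.2.1, h.1⟩
  · rintro ⟨i, j⟩ _
    rfl

/-- The chains of `Δ` supported on faces with `q` vertices, that is, of dimension `q - 1`. -/
def chains (Δ : Complex r) (q : ℕ) : Submodule k (Chain k r) where
  carrier := {c | ∀ A, c A ≠ 0 → A ∈ Δ ∧ A.card = q}
  zero_mem' A h := absurd rfl h
  add_mem' {c c'} hc hc' A h := by
    by_cases h0 : c A = 0
    · exact hc' A fun h1 => h (by rw [Pi.add_apply, h0, h1, add_zero])
    · exact hc A h0
  smul_mem' a c hc A h := hc A fun h0 => h (by rw [Pi.smul_apply, h0, smul_zero])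

def cycles (Δ : Complex r) (q : ℕ) : Submodule k (Chain k r) :=
  chains k Δ q ⊓ LinearMap.ker (boundary k)

def boundaries (Δ : Complex r) (q : ℕ) : Submodule k (Chain k r) :=
  (chains k Δ (q + 1)).map (boundary k)

/-- `Homology k Δ q` is the reduced homology of `Δ` in dimension `q - 1`: the index `q` counts
vertices of faces, so that `q = 0` is dimension `-1`. -/
def Homology (Δ : Complex r) (q : ℕ) : Type u :=
  ↥(cycles k Δ q) ⧸ (boundaries k Δ q).submoduleOf (cycles k Δ q)

instance (Δ : Complex r) (q : ℕ) : AddCommGroup (Homology k Δ q) :=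
  inferInstanceAs (AddCommGroup (↥(cycles k Δ q) ⧸ (boundaries k Δ q).submoduleOf (cycles k Δ q)))

instance (Δ : Complex r) (q : ℕ) : Module k (Homology k Δ q) :=
  inferInstanceAs (Module k (↥(cycles k Δ q) ⧸ (boundaries k Δ q).submoduleOf (cycles k Δ q)))

/-- The homology class of a cycle. -/
def homologyClass (Δ : Complex r) (q : ℕ) : ↥(cycles k Δ q) →ₗ[k] Homology k Δ q :=
  ((boundaries k Δ q).submoduleOf (cycles k Δ q)).mkQ

theorem homologyClass_surjective (Δ : Complex r) (q : ℕ) :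
    Function.Surjective (homologyClass k Δ q) :=
  Submodule.mkQ_surjective _

theorem homologyClass_eq_zero_iff {Δ : Complex r} {q : ℕ} (z : ↥(cycles k Δ q)) :
    homologyClass k Δ q z = 0 ↔ (z : Chain k r) ∈ boundaries k Δ q :=
  Submodule.Quotient.mk_eq_zero _

/-- The total reduced homology of `Δ`. -/
abbrev TotalHomology (Δ : Complex r) : Type u := ⨁ q : ℕ, Homology k Δ q

variable {k}

theorem chains_mono {Δ Δ' : Complex r} (h : Δ ≤ Δ') (q : ℕ) : chains k Δ q ≤ chains k Δ' q :=
  fun _ hc A hA => ⟨h (hc A hA).1, (hc A hA).2⟩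

theorem cycles_mono {Δ Δ' : Complex r} (h : Δ ≤ Δ') (q : ℕ) : cycles k Δ q ≤ cycles k Δ' q :=
  inf_le_inf_right _ (chains_mono h q)

theorem boundary_mem_chains {Δ : Complex r} {q : ℕ} {c : Chain k r}
    (hc : c ∈ chains k Δ (q + 1)) : boundary k c ∈ chains k Δ q := by
  intro B hB
  rw [boundary_apply] at hB
  obtain ⟨i, hi, h⟩ := Finset.exists_ne_zero_of_sum_ne_zero hB
  rw [Finset.mem_compl] at hi
  have h' := hc _ (right_ne_zero_of_mul h)
  refine ⟨Δ.lower (Finset.subset_insert i B) h'.1, ?_⟩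
  have h2 := h'.2
  rw [Finset.card_insert_of_notMem hi] at h2
  exact Nat.succ_injective h2

/-- The map in reduced homology induced by an inclusion of complexes. -/
def homologyMap {Δ Δ' : Complex r} (h : Δ ≤ Δ') (q : ℕ) : Homology k Δ q →ₗ[k] Homology k Δ' q :=
  Submodule.mapQ _ _ (Submodule.inclusion (cycles_mono h q)) fun _ hx =>
    Submodule.map_mono (chains_mono h (q + 1)) hx

open Classical in
/-- The part `c₁` of a chain `c` supported on the faces of `Δ₁`. If `c` is a chain of `Δ₁ ⊔ Δ₂`
then `c = c₁ - c₂` where `c₂ = c₁ - c` is a chain of `Δ₂`. -/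
def restrict (Δ₁ : Complex r) : Chain k r →ₗ[k] Chain k r where
  toFun c := fun A => if A ∈ Δ₁ then c A else 0
  map_add' c c' := by
    ext A
    by_cases h : A ∈ Δ₁ <;> simp [h]
  map_smul' a c := by
    ext A
    by_cases h : A ∈ Δ₁ <;> simp [h]

theorem restrict_mem {Δ₁ Δ₂ : Complex r} {q : ℕ} {c : Chain k r}
    (hc : c ∈ chains k (Δ₁ ⊔ Δ₂) q) : restrict Δ₁ c ∈ chains k Δ₁ q := by
  intro A hA
  by_cases h : A ∈ Δ₁
  · exact ⟨h, (hc A (by simpa [restrict, h] using hA)).2⟩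
  · simp [restrict, h] at hA

theorem restrict_sub_mem {Δ₁ Δ₂ : Complex r} {q : ℕ} {c : Chain k r}
    (hc : c ∈ chains k (Δ₁ ⊔ Δ₂) q) : restrict Δ₁ c - c ∈ chains k Δ₂ q := by
  intro A hA
  by_cases h : A ∈ Δ₁
  · simp [restrict, h] at hA
  · have hA' : c A ≠ 0 := by simpa [restrict, h] using hA
    exact ⟨(LowerSet.mem_sup_iff.1 (hc A hA').1).resolve_left h, (hc A hA').2⟩

theorem mem_chains_inf {Δ₁ Δ₂ : Complex r} {q : ℕ} {c : Chain k r}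
    (h₁ : c ∈ chains k Δ₁ q) (h₂ : c ∈ chains k Δ₂ q) : c ∈ chains k (Δ₁ ⊓ Δ₂) q :=
  fun A hA => ⟨LowerSet.mem_inf_iff.2 ⟨(h₁ A hA).1, (h₂ A hA).1⟩, (h₁ A hA).2⟩

/-- On cycles: `f = c₁ - c₂ ↦ d c₁ = d c₂`, for the decomposition given by `restrict`. -/
def connectingCycles (Δ₁ Δ₂ : Complex r) (q : ℕ) :
    ↥(cycles k (Δ₁ ⊔ Δ₂) (q + 1)) →ₗ[k] ↥(cycles k (Δ₁ ⊓ Δ₂) q) :=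
  LinearMap.codRestrict _
    (((boundary k).comp (restrict Δ₁)).comp (cycles k (Δ₁ ⊔ Δ₂) (q + 1)).subtype) <| by
    rintro ⟨f, hf, hdf⟩
    replace hdf : boundary k f = 0 := hdf
    refine ⟨mem_chains_inf (boundary_mem_chains (restrict_mem hf)) ?_, boundary_boundary k _⟩
    have h := boundary_mem_chains (restrict_sub_mem hf)
    rwa [map_sub, hdf, sub_zero] at h

theorem boundary_restrict_sub_mem {Δ₁ Δ₂ : Complex r} {q : ℕ} {c₁ c₂ : Chain k r}
    (h₁ : c₁ ∈ chains k Δ₁ (q + 1)) (h₂ : c₂ ∈ chains k Δ₂ (q + 1)) :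
    boundary k (restrict Δ₁ (c₁ - c₂)) - boundary k c₁ ∈ boundaries k (Δ₁ ⊓ Δ₂) q := by
  have hc : c₁ - c₂ ∈ chains k (Δ₁ ⊔ Δ₂) (q + 1) :=
    sub_mem (chains_mono le_sup_left _ h₁) (chains_mono le_sup_right _ h₂)
  rw [← map_sub]
  refine Submodule.mem_map_of_mem (mem_chains_inf (sub_mem (restrict_mem hc) h₁) ?_)
  have h := sub_mem (restrict_sub_mem hc) h₂
  have e : restrict Δ₁ (c₁ - c₂) - (c₁ - c₂) - c₂ = restrict Δ₁ (c₁ - c₂) - c₁ := by abel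
  rwa [e] at h

/-- The connecting homomorphism of the Mayer-Vietoris sequence of `Δ₁` and `Δ₂`; it does not
depend on the decomposition used, see `mayerVietoris_mk`. -/
def mayerVietoris (Δ₁ Δ₂ : Complex r) (q : ℕ) :
    Homology k (Δ₁ ⊔ Δ₂) (q + 1) →ₗ[k] Homology k (Δ₁ ⊓ Δ₂) q :=
  Submodule.mapQ _ _ (connectingCycles Δ₁ Δ₂ q) <| by
    rintro ⟨f, hf⟩ ⟨g, hg, hgf⟩
    replace hgf : boundary k g = f := hgf
    have h := boundary_restrict_sub_mem (boundary_mem_chains (restrict_mem hg))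
      (boundary_mem_chains (restrict_sub_mem hg))
    rw [map_sub (boundary k) (restrict Δ₁ g) g, sub_sub_cancel, boundary_boundary, sub_zero,
      hgf] at h
    exact h

theorem mayerVietoris_mk {Δ₁ Δ₂ : Complex r} {q : ℕ} {c₁ c₂ : Chain k r}
    (h₁ : c₁ ∈ chains k Δ₁ (q + 1)) (h₂ : c₂ ∈ chains k Δ₂ (q + 1))
    (hf : c₁ - c₂ ∈ cycles k (Δ₁ ⊔ Δ₂) (q + 1)) (hd : boundary k c₁ ∈ cycles k (Δ₁ ⊓ Δ₂) q) :
    mayerVietoris (k := k) Δ₁ Δ₂ q (homologyClass k _ _ ⟨c₁ - c₂, hf⟩) =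
      homologyClass k _ _ ⟨boundary k c₁, hd⟩ :=
  (Submodule.Quotient.eq _).2 (boundary_restrict_sub_mem h₁ h₂)

theorem emptyFace_mem_cycles {Δ : Complex r} (h : ∅ ∈ Δ) :
    (Pi.single ∅ 1 : Chain k r) ∈ cycles k Δ 0 := by
  refine ⟨fun A hA => ?_, ?_⟩
  · have : A = ∅ := by
      by_contra h0
      exact hA (Pi.single_eq_of_ne h0 _)
    subst this
    exact ⟨h, Finset.card_empty⟩
  · exact (boundary_single k ∅).trans Finset.sum_empty

variable (k) in
/-- The class of the empty face, in reduced homology in dimension `-1`. -/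
def emptyClass (Δ : Complex r) (h : ∅ ∈ Δ) : Homology k Δ 0 :=
  homologyClass k Δ 0 ⟨Pi.single ∅ 1, emptyFace_mem_cycles h⟩

theorem empty_mem_pointComplex : ∅ ∈ pointComplex r :=
  mem_lowerClosure.2 ⟨∅, rfl, le_rfl⟩

variable (k r) in
/-- The class of the empty face is a basis of the reduced homology of `{∅}` in dimension `-1`. -/
def pointBasis : Module.Basis Unit k (Homology k (pointComplex r) 0) :=
  Module.Basis.mk (v := fun _ => emptyClass k (pointComplex r) empty_mem_pointComplex)
    (by
      refine LinearIndependent.of_subsingleton () fun h => ?_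
      obtain ⟨g, hg, hg'⟩ := (homologyClass_eq_zero_iff k _).1 h
      replace hg' : boundary k g = Pi.single ∅ 1 := hg'
      have hg0 : g = 0 := by
        ext A
        by_contra hA
        obtain ⟨h1, h2⟩ := hg A hA
        obtain ⟨B, hB, hAB⟩ := mem_lowerClosure.1 h1
        rw [Set.mem_singleton_iff.1 hB] at hAB
        rw [Finset.subset_empty.1 hAB] at h2
        exact absurd h2 (by simp)
      have h3 := congrFun hg' ∅
      rw [hg0, map_zero, Pi.single_eq_same, Pi.zero_apply] at h3
      exact zero_ne_one h3)
    (by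
      rintro x -
      obtain ⟨⟨z, hz⟩, rfl⟩ := homologyClass_surjective k _ _ x
      refine Submodule.mem_span_range_iff_exists_fun k |>.2 ⟨fun _ => z ∅, ?_⟩
      rw [Fintype.sum_unique, emptyClass, ← map_smul]
      congr 1
      refine Subtype.ext (funext fun A => ?_)
      by_cases hA : A = ∅
      · subst hA
        simp
      · have h0 : z A = 0 := by
          by_contra h
          exact hA (Finset.card_eq_zero.1 (hz.1 A h).2)
        simp [hA, h0])

end Homology

/-! ### Based complexes and multigraded complexes -/

/-- A sequence `⋯ → V₂ → V₁ → V₀` of `k`-vector spaces, each with a fixed finite basis.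
The map `d i` goes from degree `i + 1` to degree `i`. -/
structure BasedSeq (k : Type u) [Field k] where
  V : ℕ → Type u
  [addCommGroup : ∀ i, AddCommGroup (V i)]
  [module : ∀ i, Module k (V i)]
  I : ℕ → Type
  [fintype : ∀ i, Fintype (I i)]
  basis : ∀ i, Module.Basis (I i) k (V i)
  d : ∀ i, V (i + 1) →ₗ[k] V i

attribute [instance] BasedSeq.addCommGroup BasedSeq.module BasedSeq.fintype

/-- `U`, with the basis of `U₁` enumerated by `e`, is an `r`-frame: a finite complex with
`U₀ = k`, `U₁ = k^r`, such that the differential sends each basis element of `U₁` to `1`, the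
basis element of `U₀`. -/
structure IsFrame {k : Type u} [Field k] {r : ℕ} (U : BasedSeq k) (e : Fin r ≃ U.I 1) : Prop where
  d_comp_d : ∀ i x, U.d i (U.d (i + 1) x) = 0
  bounded : ∃ N, ∀ i, N ≤ i → IsEmpty (U.I i)
  degree_zero : ∃ u : U.I 0, (∀ v, v = u) ∧ ∀ j, U.d 0 (U.basis 1 (e j)) = U.basis 0 u

/-- A sequence `⋯ → F₂ → F₁ → F₀` of free modules over `S = k[x₁, …, x_n]`, each with a fixed
finite basis whose elements have been assigned multidegrees. A monomial is written as its exponent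
vector. The maps are multigraded if `IsMultigraded` holds. -/
structure MultigradedSeq (k : Type u) [Field k] (n : ℕ) where
  F : ℕ → Type u
  [addCommGroup : ∀ i, AddCommGroup (F i)]
  [module : ∀ i, Module (MvPolynomial (Fin n) k) (F i)]
  I : ℕ → Type
  [fintype : ∀ i, Fintype (I i)]
  basis : ∀ i, Module.Basis (I i) (MvPolynomial (Fin n) k) (F i)
  mdeg : ∀ i, I i → (Fin n →₀ ℕ)
  d : ∀ i, F (i + 1) →ₗ[MvPolynomial (Fin n) k] F i

attribute [instance] MultigradedSeq.addCommGroup MultigradedSeq.module MultigradedSeq.fintype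

section Multigraded

variable {k : Type u} [Field k] {n r : ℕ}

/-- The differentials are multigraded: each matrix entry from `v` to `u` is zero or a scalar
multiple of the monomial `mdeg v / mdeg u`. -/
def MultigradedSeq.IsMultigraded (G : MultigradedSeq k n) : Prop :=
  ∀ i (v : G.I (i + 1)) (u : G.I i), (G.basis i).repr (G.d i (G.basis (i + 1) v)) u = 0 ∨
    ∃ (a : Fin n →₀ ℕ) (c : k), G.mdeg i u + a = G.mdeg (i + 1) v ∧
      (G.basis i).repr (G.d i (G.basis (i + 1) v)) u = MvPolynomial.monomial a c

/-- Equality of sequences with fixed multigraded bases: an isomorphism which induces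
multidegree-preserving bijections between the fixed bases. -/
def MultigradedSeq.Equal (G H : MultigradedSeq k n) : Prop :=
  ∃ (φ : ∀ i, G.F i ≃ₗ[MvPolynomial (Fin n) k] H.F i) (e : ∀ i, G.I i ≃ H.I i),
    (∀ i v, φ i (G.basis i v) = H.basis i (e i v)) ∧
    (∀ i v, H.mdeg i (e i v) = G.mdeg i v) ∧
    ∀ i x, φ i (G.d i x) = H.d i (φ (i + 1) x)

/-- `G` is a minimal multigraded free resolution of `S/M`: a finite sequence of finitely generated
multigraded free modules, exact in positive degrees, with a multigraded isomorphism from the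
cokernel of `d 0` to `S/M` (given by an augmentation `ε`), and with every differential
mapping into `(x₁, …, x_n)` times its target. -/
structure MultigradedSeq.IsMinimalFreeResolution (G : MultigradedSeq k n)
    (M : Ideal (MvPolynomial (Fin n) k)) : Prop where
  bounded : ∃ N, ∀ i, N ≤ i → IsEmpty (G.I i)
  isMultigraded : G.IsMultigraded
  exact : ∀ i, Function.Exact (G.d (i + 1)) (G.d i)
  augmentation : ∃ ε : G.F 0 →ₗ[MvPolynomial (Fin n) k] MvPolynomial (Fin n) k ⧸ M,
    Function.Surjective ε ∧ Function.Exact (G.d 0) ε ∧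
    ∀ u, ∃ c : k, ε (G.basis 0 u) = Ideal.Quotient.mk M (MvPolynomial.monomial (G.mdeg 0 u) c)
  minimal : ∀ i, LinearMap.range (G.d i) ≤
    (Ideal.span (Set.range MvPolynomial.X) : Ideal (MvPolynomial (Fin n) k)) •
      (⊤ : Submodule (MvPolynomial (Fin n) k) (G.F i))

open Classical in
/-- Multidegrees of the basis elements in the homogenization: `1` in degree `0`, `m_j` for the
`j`-th basis element in degree `1`, and then for a basis element `v` of degree `≥ 2` the lcm of the
multidegrees of the basis elements which occur in `d v`. -/
def homogenizationMdeg (m : Fin r → (Fin n →₀ ℕ)) (U : BasedSeq k) (e : Fin r ≃ U.I 1) :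
    ∀ i, U.I i → (Fin n →₀ ℕ)
  | 0 => fun _ => 0
  | 1 => fun v => m (e.symm v)
  | (i + 2) => fun v =>
      (Finset.univ.filter fun u : U.I (i + 1) =>
        (U.basis (i + 1)).repr (U.d (i + 1) (U.basis (i + 2) v)) u ≠ 0).sup
          (homogenizationMdeg m U e (i + 1))

/-- The homogenization of a frame `U` with respect to monomials `m₁, …, m_r`: if
`d v = ∑ α_u u` in `U`, then `d v = ∑ α_u (mdeg v / mdeg u) u` in the homogenization. -/
def homogenization (m : Fin r → (Fin n →₀ ℕ)) (U : BasedSeq k) (e : Fin r ≃ U.I 1) :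
    MultigradedSeq k n where
  F i := U.I i →₀ MvPolynomial (Fin n) k
  I := U.I
  basis _ := Finsupp.basisSingleOne
  mdeg := homogenizationMdeg m U e
  d i := Finsupp.linearCombination _ fun v : U.I (i + 1) => ∑ u : U.I i,
    Finsupp.single u (MvPolynomial.monomial
      (homogenizationMdeg m U e (i + 1) v - homogenizationMdeg m U e i u)
      ((U.basis i).repr (U.d i (U.basis (i + 1) v)) u))

end Multigraded

/-! ### Monomial ideals, the lcm-lattice, and rigidity -/

section Lattice

variable {n r : ℕ}

/-- `M` is a monomial ideal minimally generated by the monomials with exponents `m₁, …, m_r`. -/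
structure IsMinimallyGeneratedBy {k : Type u} [Field k] (M : Ideal (MvPolynomial (Fin n) k))
    (m : Fin r → (Fin n →₀ ℕ)) : Prop where
  span_eq : Ideal.span (Set.range fun j => MvPolynomial.monomial (m j) (1 : k)) = M
  minimal : ∀ i j, m i ≤ m j → i = j

variable (m : Fin r → (Fin n →₀ ℕ))

/-- The lcm-lattice `L_M`: all lcms of sets of generators, as exponent vectors. The order of
exponent vectors is divisibility, and `0` is the monomial `1`. -/
def lcmLattice : Finset (Fin n →₀ ℕ) := Finset.univ.image fun A : Finset (Fin r) => A.sup m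

/-- The elements `≠ 1` of the lcm-lattice. -/
abbrev lcmLattice' : Finset (Fin n →₀ ℕ) := (lcmLattice m).erase 0

/-- `A_μ`: the generators dividing `μ`. -/
def atomsBelow (μ : Fin n →₀ ℕ) : Finset (Fin r) := Finset.univ.filter fun i => m i ≤ μ

/-- `β` is covered by `μ` in the lcm-lattice. -/
def Covered (β μ : Fin n →₀ ℕ) : Prop :=
  β ∈ lcmLattice m ∧ β < μ ∧ ∀ γ ∈ lcmLattice m, β < γ → ¬γ < μ

/-- The simplicial complex `Δ_μ = ⟨A_β : β covered by μ⟩` at `μ ≠ 1`. For an atom `μ` the only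
such `β` is `1` and the complex is `{∅}`. -/
def Delta (μ : Fin n →₀ ℕ) : Complex r := generated {A | ∃ β, Covered m β μ ∧ A = atomsBelow m β}

variable {m} in
theorem exists_covered {β μ : Fin n →₀ ℕ} (hβ : β ∈ lcmLattice m) (h : β < μ) :
    ∃ γ, β ≤ γ ∧ Covered m γ μ := by
  classical
  obtain ⟨γ, hγ, hmax⟩ := (((lcmLattice m).filter (· < μ)).finite_toSet).exists_le_maximal
    (Finset.mem_coe.2 (Finset.mem_filter.2 ⟨hβ, h⟩))
  have h1 := Finset.mem_filter.1 (Finset.mem_coe.1 hmax.prop)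
  exact ⟨γ, hγ, h1.1, h1.2, fun ν hν hlt hνμ =>
    hmax.not_gt (Finset.mem_coe.2 (Finset.mem_filter.2 ⟨hν, hνμ⟩)) hlt⟩

theorem sup_mem_lcmLattice (A : Finset (Fin r)) : A.sup m ∈ lcmLattice m :=
  Finset.mem_image_of_mem _ (Finset.mem_univ A)

theorem subset_atomsBelow_iff {A : Finset (Fin r)} {μ : Fin n →₀ ℕ} :
    A ⊆ atomsBelow m μ ↔ A.sup m ≤ μ := by
  rw [Finset.sup_le_iff, Finset.subset_iff]
  simp [atomsBelow]

theorem mem_Delta_of_sup_lt {A : Finset (Fin r)} {μ : Fin n →₀ ℕ} (h : A.sup m < μ) :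
    A ∈ Delta m μ := by
  obtain ⟨γ, hγ, hc⟩ := exists_covered (sup_mem_lcmLattice m A) h
  exact mem_lowerClosure.2 ⟨_, ⟨γ, hc, rfl⟩, (subset_atomsBelow_iff m).2 hγ⟩

theorem empty_mem_Delta (μ : lcmLattice' m) : ∅ ∈ Delta m μ.1 := by
  refine mem_Delta_of_sup_lt m ?_
  rw [Finset.sup_empty]
  exact bot_lt_iff_ne_bot.2 (Finset.ne_of_mem_erase μ.2)

variable (k : Type u) [Field k]

/-- The Betti poset `B_M`. -/
def bettiPoset : Set (Fin n →₀ ℕ) :=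
  {μ | μ ∈ lcmLattice m ∧ (μ = 0 ∨ Nontrivial (TotalHomology k (Delta m μ)))}

/-- For `1 < μ' < μ` in `L_M`, if the reduced homology of `Δ_{μ'}` in dimension `i` and of `Δ_μ`
in dimension `j` are nonzero, then `i < j`. (Here `p = i + 1` and `q = j + 1`.) -/
def IsHomologicallyMonotonic : Prop :=
  ∀ μ' ∈ lcmLattice' m, ∀ μ ∈ lcmLattice' m, μ' < μ → ∀ p q : ℕ,
    Nontrivial (Homology k (Delta m μ') p) → Nontrivial (Homology k (Delta m μ) q) → p < q

/-- The monomial ideal generated by `m₁, …, m_r` is rigid. -/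
def IsRigid : Prop :=
  IsHomologicallyMonotonic m k ∧
    ∀ μ ∈ bettiPoset m k, μ ≠ 0 → Nonempty (TotalHomology k (Delta m μ) ≃ₗ[k] k)

/-! ### The poset construction -/

/-- `𝓑(μ)`, the elements of the Betti poset strictly below `μ`. -/
def bettiBelow (μ : Fin n →₀ ℕ) : Set (Fin n →₀ ℕ) := {β | β ∈ bettiPoset m k ∧ β < μ}

/-- The maximal elements `β₁, …, β_l` of `𝓑(μ)`. -/
def maxBettiBelow (μ : Fin n →₀ ℕ) : Set (Fin n →₀ ℕ) := {β | Maximal (· ∈ bettiBelow m k μ) β}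

/-- `⟨A_{β₁}, …, A_{β_l}⟩`. -/
def tildeDelta (μ : Fin n →₀ ℕ) : Complex r := generated (atomsBelow m '' maxBettiBelow m k μ)

/-- `⟨A_{β_i} : β_i ≠ β⟩`. -/
def restDelta (μ β : Fin n →₀ ℕ) : Complex r :=
  generated (atomsBelow m '' (maxBettiBelow m k μ \ {β}))

theorem tildeDelta_le (μ : Fin n →₀ ℕ) : tildeDelta m k μ ≤ Delta m μ := by
  rintro A hA
  obtain ⟨_, ⟨β, hβ, rfl⟩, hle⟩ := mem_lowerClosure.1 hA
  exact mem_Delta_of_sup_lt m (((subset_atomsBelow_iff m).1 hle).trans_lt hβ.prop.2)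

theorem tildeDelta_le_sup (μ β : Fin n →₀ ℕ) :
    tildeDelta m k μ ≤ generated {atomsBelow m β} ⊔ restDelta m k μ β := by
  rintro A hA
  obtain ⟨_, ⟨γ, hγ, rfl⟩, hle⟩ := mem_lowerClosure.1 hA
  refine LowerSet.mem_sup_iff.2 ?_
  by_cases h : γ = β
  · subst h
    exact Or.inl (mem_lowerClosure.2 ⟨_, rfl, hle⟩)
  · exact Or.inr (mem_lowerClosure.2 ⟨_, ⟨γ, ⟨hγ, h⟩, rfl⟩, hle⟩)

theorem inf_restDelta_le {μ β : Fin n →₀ ℕ} (hβ : β ∈ maxBettiBelow m k μ) :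
    generated {atomsBelow m β} ⊓ restDelta m k μ β ≤ Delta m β := by
  rintro A hA
  obtain ⟨h1, h2⟩ := LowerSet.mem_inf_iff.1 hA
  obtain ⟨_, rfl, hle⟩ := mem_lowerClosure.1 h1
  obtain ⟨_, ⟨γ, ⟨hγ, hne⟩, rfl⟩, hle'⟩ := mem_lowerClosure.1 h2
  rw [subset_atomsBelow_iff] at hle hle'
  refine mem_Delta_of_sup_lt m (lt_of_le_of_ne hle fun h => hne ?_)
  rw [h] at hle'
  exact (hβ.eq_of_le hγ.prop hle').symm

/-- The map induced in homology by the inclusion of `tildeDelta` into `Delta`. -/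
def sigmaMap (μ : Fin n →₀ ℕ) (q : ℕ) :
    Homology k (tildeDelta m k μ) q →ₗ[k] Homology k (Delta m μ) q :=
  homologyMap (tildeDelta_le m k μ) q

open Classical in
/-- The inverse of `sigmaMap`, which is in fact an isomorphism for every `μ ≠ 1` in the
lcm-lattice; this fact is not assumed anywhere, and the default value `0` is only there to make the
definition possible before it is known. -/
def sigmaInv (μ : Fin n →₀ ℕ) (q : ℕ) :
    Homology k (Delta m μ) q →ₗ[k] Homology k (tildeDelta m k μ) q :=
  if h : Function.Bijective (sigmaMap m k μ q) then (LinearEquiv.ofBijective _ h).symm else 0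

open Classical in
/-- The component `φ_{i,μ}^β` with `i = q + 2`, from the homology of `Δ_μ` in dimension `i - 2`
to the homology of `Δ_β` in dimension `i - 3`: if `β` is one of the maximal elements of `𝓑(μ)` it
is `ι ∘ δ ∘ σ_μ⁻¹` with the Mayer-Vietoris connecting map `δ` of the decomposition of `tildeDelta`
into `⟨A_β⟩` and the rest, and otherwise it is zero. -/
def phiComponent (μ β : Fin n →₀ ℕ) (q : ℕ) :
    Homology k (Delta m μ) (q + 1) →ₗ[k] Homology k (Delta m β) q :=
  if hβ : β ∈ maxBettiBelow m k μ then
    homologyMap (inf_restDelta_le m k hβ) q ∘ₗ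
      mayerVietoris (generated {atomsBelow m β}) (restDelta m k μ β) q ∘ₗ
      homologyMap (tildeDelta_le_sup m k μ β) (q + 1) ∘ₗ
      sigmaInv m k μ (q + 1)
  else 0

open Classical in
/-- The component of `φ₁` at `μ`: the identity of the homology of `{∅}` if `Δ_μ = {∅}`. (Otherwise
the homology of `Δ_μ` in dimension `-1` is zero.) -/
def phiOne (μ : Fin n →₀ ℕ) : Homology k (Delta m μ) 0 →ₗ[k] Homology k (pointComplex r) 0 :=
  if h : Delta m μ = pointComplex r then homologyMap h.le 0 else 0

/-- The spaces `𝓓_i`: `𝓓_0` is the homology of `{∅}` in dimension `-1`, and `𝓓_i` for `i ≥ 1` is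
the direct sum of the homologies of the `Δ_μ`, `1 ≠ μ ∈ L_M`, in dimension `i - 2`. -/
def PosetSpace : ℕ → Type u
  | 0 => Homology k (pointComplex r) 0
  | (q + 1) => ⨁ μ : lcmLattice' m, Homology k (Delta m μ.1) q

instance : ∀ i, AddCommGroup (PosetSpace m k i)
  | 0 => inferInstanceAs (AddCommGroup (Homology k (pointComplex r) 0))
  | (q + 1) => inferInstanceAs (AddCommGroup (⨁ μ : lcmLattice' m, Homology k (Delta m μ.1) q))

instance : ∀ i, Module k (PosetSpace m k i)
  | 0 => inferInstanceAs (Module k (Homology k (pointComplex r) 0))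
  | (q + 1) => inferInstanceAs (Module k (⨁ μ : lcmLattice' m, Homology k (Delta m μ.1) q))

/-- The inclusion of the summand at `μ` into `𝓓_{q+1}`. -/
def inclusionAt (μ : lcmLattice' m) (q : ℕ) :
    Homology k (Delta m μ.1) q →ₗ[k] PosetSpace m k (q + 1) :=
  DirectSum.lof k (lcmLattice' m) (fun μ => Homology k (Delta m μ.1) q) μ

/-- The projection of `𝓓_{q+1}` onto the summand at `μ`. -/
def projectionAt (μ : lcmLattice' m) (q : ℕ) :
    PosetSpace m k (q + 1) →ₗ[k] Homology k (Delta m μ.1) q :=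
  DirectSum.component k (lcmLattice' m) (fun μ => Homology k (Delta m μ.1) q) μ

/-- The maps `φ_{i+1} : 𝓓_{i+1} → 𝓓_i`, defined componentwise. -/
def phi : ∀ i, PosetSpace m k (i + 1) →ₗ[k] PosetSpace m k i
  | 0 => ∑ μ : lcmLattice' m, (phiOne m k μ.1 ∘ₗ projectionAt m k μ 0 :
      PosetSpace m k 1 →ₗ[k] Homology k (pointComplex r) 0)
  | (q + 1) => ∑ μ : lcmLattice' m, ∑ β : lcmLattice' m,
      inclusionAt m k β q ∘ₗ phiComponent m k μ.1 β.1 q ∘ₗ projectionAt m k μ (q + 1)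

/-- A choice of a basis of every reduced homology space of every `Δ_μ`, `1 ≠ μ ∈ L_M`. In dimension
`-1`, where the homology is nonzero only for the atoms, the basis element is the class of the
empty face. -/
structure HomologyBasis where
  basis : ∀ (μ : lcmLattice' m) (q : ℕ),
    Module.Basis (Fin (Module.finrank k (Homology k (Delta m μ.1) q))) k
      (Homology k (Delta m μ.1) q)
  basis_zero : ∀ (μ : lcmLattice' m) x, basis μ 0 x = emptyClass k (Delta m μ.1) (empty_mem_Delta m μ)

/-- The index type of the basis of `𝓓_i`. -/
def PosetIndex : ℕ → Type
  | 0 => Unit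
  | (q + 1) => Σ μ : lcmLattice' m, Fin (Module.finrank k (Homology k (Delta m μ.1) q))

instance : ∀ i, Fintype (PosetIndex m k i)
  | 0 => inferInstanceAs (Fintype Unit)
  | (q + 1) => inferInstanceAs
      (Fintype (Σ μ : lcmLattice' m, Fin (Module.finrank k (Homology k (Delta m μ.1) q))))

variable {m k}

/-- The basis of `𝓓_i` assembled from the chosen bases of the summands. -/
def posetBasis (b : HomologyBasis m k) : ∀ i, Module.Basis (PosetIndex m k i) k (PosetSpace m k i)
  | 0 => pointBasis k r
  | (q + 1) => DFinsupp.basis fun μ : lcmLattice' m => b.basis μ q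

/-- The poset construction `𝓓(L_M)`. -/
def posetConstruction (b : HomologyBasis m k) : BasedSeq k where
  V := PosetSpace m k
  I := PosetIndex m k
  basis := posetBasis b
  d := phi m k

variable (m k)

/-- The multidegree of a basis element: `1` in degree `0`, and `μ` for a basis element in the
summand at `μ`. -/
def posetMdeg : ∀ i, PosetIndex m k i → (Fin n →₀ ℕ)
  | 0 => fun _ => 0
  | (_ + 1) => fun v => v.1.1

/-- The maps `∂_{i+1} : S ⊗ 𝓓_{i+1} → S ⊗ 𝓓_i`, obtained by multiplying the component of `φ_{i+1}`
from the summand at `μ` to the summand at `β` by `μ / β` (and by `μ` for `i = 0`). -/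
def homogeneousPhi : ∀ i, MvPolynomial (Fin n) k ⊗[k] PosetSpace m k (i + 1)
    →ₗ[MvPolynomial (Fin n) k] MvPolynomial (Fin n) k ⊗[k] PosetSpace m k i
  | 0 => ∑ μ : lcmLattice' m, MvPolynomial.monomial μ.1 (1 : k) •
      LinearMap.baseChange (MvPolynomial (Fin n) k) (phiOne m k μ.1 ∘ₗ projectionAt m k μ 0 :
        PosetSpace m k 1 →ₗ[k] PosetSpace m k 0)
  | (q + 1) => ∑ μ : lcmLattice' m, ∑ β : lcmLattice' m,
      MvPolynomial.monomial (μ.1 - β.1) (1 : k) •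
        LinearMap.baseChange (MvPolynomial (Fin n) k)
          (inclusionAt m k β q ∘ₗ phiComponent m k μ.1 β.1 q ∘ₗ projectionAt m k μ (q + 1))

variable {m k}

/-- The sequence `𝓕(L_M)` of multigraded free modules, with `𝓕_i = S ⊗ 𝓓_i`. -/
def posetResolution (b : HomologyBasis m k) : MultigradedSeq k n where
  F i := MvPolynomial (Fin n) k ⊗[k] PosetSpace m k i
  I := PosetIndex m k
  basis i := Algebra.TensorProduct.basis (MvPolynomial (Fin n) k) (posetBasis b i)
  mdeg := posetMdeg m k
  d := homogeneousPhi m k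

end Lattice

end MonomialResolution

end

noncomputable section

namespace MonomialResolution

universe u

/-! ### Chains supported on monomials in an order ideal -/

section Chains

variable {k : Type u} [Field k] {n r : ℕ}

/-! The poset construction of a rigid ideal is the cellular chain complex of a filtration. An order
ideal of monomials `Y` gives the complex `supComplex m Y` of sets of generators whose lcm lies in
`Y`. For the divisors of `β` this is a full simplex, hence acyclic once it has a vertex; for the
proper divisors it is `Delta m β`. Removing one maximal lcm `μ` at a time shows that the homology of
a pair `Z ≤ Y` is built from the homologies of the `Delta m μ` with `μ` in `Y` but not in `Z`,
shifted by one (`exists_boundary_add`). In particular `sigmaMap` is bijective.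

Rigidity gives each element of the Betti poset a single degree, strictly increasing along
divisibility (`IsRigid.isBettiGraded`). Fix a monomial `α` and filter by `stage k m i α`. Betti
elements of degree `i` are pairwise incomparable and maximal in stage `i`, so the homology of stage
`i` modulo stage `i - 1` on faces with `i` vertices is the part of the `i`-th space of the
construction supported on divisors of `α`; `Represents` records this identification on chains.
Filling a cycle of `tildeDelta` inside the simplex below `μ` shows that the simplicial boundary
induces exactly the Mayer-Vietoris maps `phi` (`IsBettiGraded.exists_cell`,
`IsBettiGraded.represents_phi`). Hence `phi` squares to zero, and acyclicity of the simplex below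
`α` makes the strand at `α` exact in positive degrees (`IsBettiGraded.exists_phi_eq`).

Exactness of all strands is exactness over the polynomial ring (`exists_of_homogenized_eq_zero`).
Minimality holds because nonzero entries strictly lower the multidegree. Exactness of the strands
also forces the multidegree of a basis element to be the lcm of those in its boundary
(`IsBettiGraded.sup_posetMdeg`), which identifies the resolution with the homogenization. -/

theorem restrict_apply_of_mem {Δ : Complex r} {A : Finset (Fin r)} (h : A ∈ Δ) (c : Chain k r) :
    restrict Δ c A = c A := by
  simp [restrict, h]

theorem restrict_apply_of_notMem {Δ : Complex r} {A : Finset (Fin r)} (h : A ∉ Δ)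
    (c : Chain k r) : restrict Δ c A = 0 := by
  simp [restrict, h]

theorem restrict_apply_ne_zero {Δ : Complex r} {A : Finset (Fin r)} {c : Chain k r}
    (h : restrict Δ c A ≠ 0) : A ∈ Δ ∧ c A ≠ 0 := by
  by_cases hA : A ∈ Δ
  · exact ⟨hA, by rwa [restrict_apply_of_mem hA] at h⟩
  · exact absurd (restrict_apply_of_notMem hA c) h

theorem restrict_eq_self {Δ : Complex r} {q : ℕ} {c : Chain k r} (hc : c ∈ chains k Δ q) :
    restrict Δ c = c := by
  ext A
  by_cases hA : A ∈ Δ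
  · exact restrict_apply_of_mem hA c
  · rw [restrict_apply_of_notMem hA]
    by_contra h
    exact hA (hc A (Ne.symm h)).1

theorem exists_of_boundary_ne_zero {c : Chain k r} {B : Finset (Fin r)}
    (h : boundary k c B ≠ 0) : ∃ i ∉ B, c (insert i B) ≠ 0 := by
  rw [boundary_apply] at h
  obtain ⟨i, hi, h⟩ := Finset.exists_ne_zero_of_sum_ne_zero h
  exact ⟨i, Finset.mem_compl.1 hi, right_ne_zero_of_mul h⟩

/-- The cone with apex `i` over a chain. -/
def cone (i : Fin r) (c : Chain k r) : Chain k r :=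
  fun A => if i ∈ A then (-1 : k) ^ (A.filter (· < i)).card * c (A.erase i) else 0

/-- Coning is a contracting homotopy. At a face containing the apex, the apex term of the inner
boundary returns `c` and all other terms cancel in pairs; at a face without it, only the term
inserting the apex survives. -/
theorem boundary_cone_add (i : Fin r) (c : Chain k r) :
    boundary k (cone i c) + cone i (boundary k c) = c := by
  have hsq : ∀ p : ℕ, (-1 : k) ^ p * (-1) ^ p = 1 := fun p => by
    rw [← mul_pow]; simp
  ext B
  rw [Pi.add_apply, boundary_apply]
  by_cases hi : i ∈ B
  · have hB : (B.erase i)ᶜ = insert i Bᶜ := by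
      ext j; simp only [Finset.mem_compl, Finset.mem_erase, Finset.mem_insert]; tauto
    have hfe : (B.erase i).filter (· < i) = B.filter (· < i) := by
      ext j; simp only [Finset.mem_filter, Finset.mem_erase]
      exact ⟨fun h => ⟨h.1.2, h.2⟩, fun h => ⟨⟨h.2.ne, h.1⟩, h.2⟩⟩
    rw [cone, if_pos hi, boundary_apply, hB, Finset.sum_insert (by simpa using hi), mul_add,
      Finset.insert_erase hi, hfe, ← mul_assoc, hsq, one_mul, add_comm, add_assoc, Finset.mul_sum,
      ← Finset.sum_add_distrib, Finset.sum_eq_zero, add_zero]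
    intro j hj
    rw [Finset.mem_compl] at hj
    have hij : i ≠ j := fun h => hj (h ▸ hi)
    rw [cone, if_pos (Finset.mem_insert_of_mem hi), Finset.erase_insert_of_ne hij.symm,
      ← mul_assoc, ← mul_assoc, ← add_mul]
    convert zero_mul _
    rcases lt_or_gt_of_ne hij with h | h
    · have h1 : (insert j B).filter (· < i) = B.filter (· < i) := by
        rw [Finset.filter_insert, if_neg h.asymm]
      have h2 : B.filter (· < j) = insert i ((B.erase i).filter (· < j)) := by
        conv_lhs => rw [← Finset.insert_erase hi]
        rw [Finset.filter_insert, if_pos h]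
      rw [h1, h2, Finset.card_insert_of_notMem (by simp), pow_succ]
      ring
    · have h1 : (insert j B).filter (· < i) = insert j (B.filter (· < i)) := by
        rw [Finset.filter_insert, if_pos h]
      have h2 : B.filter (· < j) = (B.erase i).filter (· < j) := by
        conv_lhs => rw [← Finset.insert_erase hi]
        rw [Finset.filter_insert, if_neg h.asymm]
      rw [h1, h2, Finset.card_insert_of_notMem (by simp [hj]), pow_succ]
      ring
  · rw [show cone i (boundary k c) B = 0 from if_neg hi, add_zero,
      Finset.sum_eq_single_of_mem i (Finset.mem_compl.2 hi)]
    · rw [cone, if_pos (Finset.mem_insert_self _ _), Finset.erase_insert hi, Finset.filter_insert,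
        if_neg (lt_irrefl i), ← mul_assoc, hsq, one_mul]
    · intro j _ hji
      rw [cone, if_neg, mul_zero]
      rw [Finset.mem_insert, not_or]
      exact ⟨hji.symm, hi⟩

/-! ### Complexes cut out by order ideals, and their relative homology -/

variable (m : Fin r → (Fin n →₀ ℕ))

/-- The sets of generators whose lcm lies in an order ideal of monomials. -/
def supComplex (Y : LowerSet (Fin n →₀ ℕ)) : Complex r where
  carrier := {A | A.sup m ∈ Y}
  lower' _ _ hBA hA := Y.lower (Finset.sup_mono hBA) hA

variable {m}

theorem mem_supComplex {Y : LowerSet (Fin n →₀ ℕ)} {A : Finset (Fin r)} :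
    A ∈ supComplex m Y ↔ A.sup m ∈ Y := Iff.rfl

theorem supComplex_mono {Z Y : LowerSet (Fin n →₀ ℕ)} (h : Z ≤ Y) :
    supComplex m Z ≤ supComplex m Y := fun _ hA => h hA

variable (m) in
theorem generated_atomsBelow (β : Fin n →₀ ℕ) :
    generated {atomsBelow m β} = supComplex m (LowerSet.Iic β) := by
  ext A
  simp only [SetLike.mem_coe, mem_supComplex, LowerSet.mem_Iic_iff]
  rw [← subset_atomsBelow_iff]
  simp [generated]

-- Any lcm strictly below `β` lies under some element covered by `β`, so the covering relation may
-- be traded for strict divisibility.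
variable (m) in
theorem Delta_eq (β : Fin n →₀ ℕ) : Delta m β = supComplex m (LowerSet.Iio β) := by
  ext A
  simp only [SetLike.mem_coe, mem_supComplex, LowerSet.mem_Iio_iff]
  refine ⟨fun hA => ?_, mem_Delta_of_sup_lt m⟩
  obtain ⟨_, ⟨γ, hγ, rfl⟩, hle⟩ := mem_lowerClosure.1 hA
  exact ((subset_atomsBelow_iff m).1 hle).trans_lt hγ.2.1

theorem mem_Delta_iff {β : Fin n →₀ ℕ} {A : Finset (Fin r)} : A ∈ Delta m β ↔ A.sup m < β := by
  rw [Delta_eq]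
  rfl

/-- A full simplex on a nonempty set of vertices is acyclic. -/
theorem exists_boundary_eq_of_cycle {β : Fin n →₀ ℕ} {i : Fin r} (hi : m i ≤ β) {q : ℕ}
    {c : Chain k r} (hc : c ∈ chains k (supComplex m (LowerSet.Iic β)) q)
    (hd : boundary k c = 0) :
    ∃ w ∈ chains k (supComplex m (LowerSet.Iic β)) (q + 1), boundary k w = c := by
  refine ⟨cone i c, fun A hA => ?_, ?_⟩
  · have hiA : i ∈ A := by
      by_contra h
      exact hA (if_neg h)
    rw [cone, if_pos hiA] at hA
    obtain ⟨h1, h2⟩ := hc _ (right_ne_zero_of_mul hA)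
    refine ⟨?_, by rw [← Finset.card_erase_add_one hiA, h2]⟩
    rw [mem_supComplex, ← Finset.insert_erase hiA, Finset.sup_insert]
    exact sup_le hi h1
  · have h := boundary_cone_add i c
    have h0 : cone i (0 : Chain k r) = 0 := by
      ext A
      simp [cone]
    rwa [hd, h0, add_zero] at h

theorem exists_le_of_mem_lcmLattice {μ : Fin n →₀ ℕ} (hμ : μ ∈ lcmLattice m) (h0 : μ ≠ 0) :
    ∃ i, m i ≤ μ := by
  obtain ⟨A, -, rfl⟩ := Finset.mem_image.1 hμ
  rcases A.eq_empty_or_nonempty with rfl | ⟨i, hi⟩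
  · exact absurd Finset.sup_empty h0
  · exact ⟨i, Finset.le_sup hi⟩

variable (m k) in
/-- `μ` contributes to homological degree `i` of the minimal free resolution. -/
def IsBetti : ℕ → (Fin n →₀ ℕ) → Prop
  | 0, μ => μ = 0
  | q + 1, μ => μ ∈ lcmLattice' m ∧ Nontrivial (Homology k (Delta m μ) q)

theorem IsBetti.mem_lcmLattice {i : ℕ} {μ : Fin n →₀ ℕ} (h : IsBetti k m i μ) :
    μ ∈ lcmLattice m := by
  cases i with
  | zero =>
    replace h : μ = 0 := h
    rw [h]
    exact sup_mem_lcmLattice m ∅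
  | succ q => exact Finset.mem_of_mem_erase h.1

/-- The simplex below `μ` is acyclic, so the connecting map embeds its homology modulo `Delta m μ`
into the homology of `Delta m μ` one step lower, which vanishes here. For `μ = 1` only the empty set
has lcm `1`, as no generator is `1`. -/
theorem exists_of_not_isBetti (hm : ∀ i, m i ≠ 0) {j : ℕ} {μ : Fin n →₀ ℕ}
    (hμ : μ ∈ lcmLattice m) (hB : ¬IsBetti k m j μ) {c : Chain k r}
    (hc : c ∈ chains k (supComplex m (LowerSet.Iic μ)) j)
    (hd : ∀ A, boundary k c A ≠ 0 → A.sup m < μ) :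
    ∃ w ∈ chains k (supComplex m (LowerSet.Iic μ)) (j + 1), ∃ e ∈ chains k (Delta m μ) j,
      c = boundary k w + e := by
  by_cases h0 : μ = 0
  · subst h0
    cases j with
    | zero => exact absurd rfl hB
    | succ q =>
      have : c = 0 := by
        ext A
        by_contra hA
        obtain ⟨h1, h2⟩ := hc A hA
        obtain ⟨i, hi⟩ : A.Nonempty := Finset.card_pos.1 (by omega)
        exact hm i (le_bot_iff.1 ((Finset.le_sup hi).trans h1))
      exact ⟨0, zero_mem _, 0, zero_mem _, by simp [this]⟩
  cases j with
  | zero =>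
    refine ⟨0, zero_mem _, c, fun A hA => ?_, by simp⟩
    have h2 := (hc A hA).2
    rw [Finset.card_eq_zero.1 h2, mem_Delta_iff, Finset.sup_empty]
    exact ⟨bot_lt_iff_ne_bot.2 h0, rfl⟩
  | succ q =>
    have hB' : ¬Nontrivial (Homology k (Delta m μ) q) := fun h =>
      hB ⟨Finset.mem_erase.2 ⟨h0, hμ⟩, h⟩
    rw [not_nontrivial_iff_subsingleton] at hB'
    have hz : boundary k c ∈ cycles k (Delta m μ) q :=
      ⟨fun A hA => ⟨mem_Delta_iff.2 (hd A hA), (boundary_mem_chains hc A hA).2⟩,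
        boundary_boundary k c⟩
    obtain ⟨e, he, hec⟩ :=
      (homologyClass_eq_zero_iff k ⟨_, hz⟩).1 (Subsingleton.elim _ 0)
    replace hec : boundary k e = boundary k c := hec
    have hle : Delta m μ ≤ supComplex m (LowerSet.Iic μ) := fun A hA => (mem_Delta_iff.1 hA).le
    obtain ⟨i, hi⟩ := exists_le_of_mem_lcmLattice hμ h0
    obtain ⟨w, hw, hwc⟩ := exists_boundary_eq_of_cycle hi
      (sub_mem hc (chains_mono hle _ he)) (by rw [map_sub, hec, sub_self])
    exact ⟨w, hw, e, he, by rw [hwc, sub_add_cancel]⟩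

/-- If no monomial of `Y` is a proper multiple of `β`, then the boundary commutes with the
restriction to the divisors of `β`, up to faces whose lcm strictly divides `β`. -/
theorem restrict_boundary_sub_mem {Y : LowerSet (Fin n →₀ ℕ)} {β : Fin n →₀ ℕ}
    (hβ : ∀ γ ∈ Y, ¬β < γ) {j : ℕ} {c : Chain k r} (hc : c ∈ chains k (supComplex m Y) (j + 1)) :
    restrict (supComplex m (LowerSet.Iic β)) (boundary k c) -
      boundary k (restrict (supComplex m (LowerSet.Iic β)) c) ∈ chains k (Delta m β) j := by
  have hc' : restrict (supComplex m (LowerSet.Iic β)) c ∈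
      chains k (supComplex m (LowerSet.Iic β)) (j + 1) := fun A hA =>
    ⟨(restrict_apply_ne_zero hA).1, (hc A (restrict_apply_ne_zero hA).2).2⟩
  intro A hA
  rw [Pi.sub_apply] at hA
  by_cases hAβ : A ∈ supComplex m (LowerSet.Iic β)
  · rw [restrict_apply_of_mem hAβ, ← Pi.sub_apply, ← map_sub] at hA
    obtain ⟨i, hi, h⟩ := exists_of_boundary_ne_zero hA
    have hcA : c (insert i A) ≠ 0 := by
      intro h0
      by_cases hmem : insert i A ∈ supComplex m (LowerSet.Iic β)
      · exact h (by rw [Pi.sub_apply, restrict_apply_of_mem hmem, sub_self])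
      · exact h (by rw [Pi.sub_apply, restrict_apply_of_notMem hmem, h0, sub_self])
    have hnot : insert i A ∉ supComplex m (LowerSet.Iic β) := fun hmem =>
      h (by rw [Pi.sub_apply, restrict_apply_of_mem hmem, sub_self])
    obtain ⟨h1, h2⟩ := hc _ hcA
    rw [Finset.card_insert_of_notMem hi] at h2
    -- If `A` had lcm exactly `β`, the lcm of `insert i A`, which does not divide `β`, would be a
    -- proper multiple of `β` in `Y`.
    refine ⟨mem_Delta_iff.2 (lt_of_le_of_ne hAβ fun h3 => ?_), Nat.succ_injective h2⟩
    have h4 : β ≤ (insert i A).sup m := h3 ▸ Finset.sup_mono (Finset.subset_insert i A)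
    exact hβ _ h1 (lt_of_le_of_ne h4 fun h5 => hnot h5.ge)
  · rw [restrict_apply_of_notMem hAβ, zero_sub, neg_ne_zero] at hA
    exact absurd (boundary_mem_chains hc' A hA).1 hAβ

/-- Relative homology of `supComplex m Z ≤ supComplex m Y` vanishes in degree `j` if no Betti
degree in degree `j` lies in the difference. -/
theorem exists_boundary_add (hm : ∀ i, m i ≠ 0) {j : ℕ} {Z : LowerSet (Fin n →₀ ℕ)} :
    ∀ {Y : LowerSet (Fin n →₀ ℕ)}, Z ≤ Y → (∀ μ ∈ Y, μ ∉ Z → ¬IsBetti k m j μ) →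
    ∀ {c : Chain k r}, c ∈ chains k (supComplex m Y) j →
    (∀ A, boundary k c A ≠ 0 → A ∈ supComplex m Z) →
    ∃ w ∈ chains k (supComplex m Y) (j + 1), ∃ e ∈ chains k (supComplex m Z) j,
      c = boundary k w + e := by
  classical
  suffices H : ∀ (N : ℕ) (Y : LowerSet (Fin n →₀ ℕ)),
      ((lcmLattice m).filter fun μ => μ ∈ Y ∧ μ ∉ Z).card = N → Z ≤ Y →
      (∀ μ ∈ Y, μ ∉ Z → ¬IsBetti k m j μ) →
      ∀ c : Chain k r, c ∈ chains k (supComplex m Y) j →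
      (∀ A, boundary k c A ≠ 0 → A ∈ supComplex m Z) →
      ∃ w ∈ chains k (supComplex m Y) (j + 1), ∃ e ∈ chains k (supComplex m Z) j,
        c = boundary k w + e from
    fun {Y} h1 h2 {c} h3 h4 => H _ Y rfl h1 h2 c h3 h4
  intro N
  induction N with
  | zero =>
    intro Y hN _ _ c hc _
    refine ⟨0, zero_mem _, c, fun A (hA : c A ≠ 0) => ⟨?_, (hc A hA).2⟩, by simp⟩
    by_contra hAZ
    have hmem : A.sup m ∈ (lcmLattice m).filter fun μ => μ ∈ Y ∧ μ ∉ Z :=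
      Finset.mem_filter.2 ⟨sup_mem_lcmLattice m A, (hc A hA).1, hAZ⟩
    rw [Finset.card_eq_zero.1 hN] at hmem
    exact Finset.notMem_empty _ hmem
  | succ N ih =>
    intro Y hN hZY hB c hc hd
    obtain ⟨μ, hμmax⟩ : ∃ μ, Maximal (· ∈ (lcmLattice m).filter fun μ => μ ∈ Y ∧ μ ∉ Z) μ :=
      Finset.exists_maximal (Finset.card_pos.1 (by omega))
    obtain ⟨hμL, hμY, hμZ⟩ := Finset.mem_filter.1 hμmax.prop
    have hmaxY : ∀ γ ∈ lcmLattice m, γ ∈ Y → ¬μ < γ := fun γ hγ hγY hlt =>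
      hμmax.not_gt (Finset.mem_filter.2 ⟨hγ, hγY, fun h => hμZ (Z.lower hlt.le h)⟩) hlt
    -- All multiples of `μ` are discarded, but by maximality `μ` is the only one among the lcms in
    -- `Y`.
    let Y' : LowerSet (Fin n →₀ ℕ) :=
      ⟨{γ | γ ∈ Y ∧ ¬μ ≤ γ}, fun a b hba ha => ⟨Y.lower hba ha.1, fun h => ha.2 (h.trans hba)⟩⟩
    have hY'Y : Y' ≤ Y := fun γ hγ => hγ.1
    have hZY' : Z ≤ Y' := fun γ hγ => ⟨hZY hγ, fun h => hμZ (Z.lower h hγ)⟩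
    have hcard : ((lcmLattice m).filter fun γ => γ ∈ Y' ∧ γ ∉ Z).card = N := by
      have : ((lcmLattice m).filter fun γ => γ ∈ Y ∧ γ ∉ Z) =
          insert μ ((lcmLattice m).filter fun γ => γ ∈ Y' ∧ γ ∉ Z) := by
        ext γ
        simp only [Finset.mem_filter, Finset.mem_insert]
        constructor
        · rintro ⟨h1, h2, h3⟩
          by_cases h : μ ≤ γ
          · exact Or.inl (h.antisymm (by
              by_contra h'
              exact hmaxY γ h1 h2 (lt_of_le_not_ge h h'))).symm
          · exact Or.inr ⟨h1, ⟨h2, h⟩, h3⟩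
        · rintro (rfl | ⟨h1, h2, h3⟩)
          · exact ⟨hμL, hμY, hμZ⟩
          · exact ⟨h1, h2.1, h3⟩
      rw [this, Finset.card_insert_of_notMem] at hN
      · exact Nat.succ_injective hN
      · intro h
        exact (Finset.mem_filter.1 h).2.1.2 le_rfl
    set R := restrict (k := k) (supComplex m (LowerSet.Iic μ)) with hR
    have hRc : R c ∈ chains k (supComplex m (LowerSet.Iic μ)) j := fun A hA =>
      ⟨(restrict_apply_ne_zero hA).1, (hc A (restrict_apply_ne_zero hA).2).2⟩
    -- No face of lcm `μ` occurs in the boundary of `R c`: there `boundary k c` vanishes because `μ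
    -- ∉ Z`, and a contribution of `c - R c` would need a face whose lcm is a proper multiple of `μ`
    -- in `Y`.
    have hdR : ∀ A, boundary k (R c) A ≠ 0 → A.sup m < μ := by
      intro A hA
      obtain ⟨i, hi, h⟩ := exists_of_boundary_ne_zero hA
      refine lt_of_le_of_ne ((Finset.sup_mono (Finset.subset_insert i A)).trans
        (restrict_apply_ne_zero h).1) fun hAμ => ?_
      have h0 : boundary k c A = 0 := by
        by_contra h0
        exact hμZ (hAμ ▸ hd A h0)
      have h1 : boundary k (c - R c) A ≠ 0 := by
        rw [map_sub, Pi.sub_apply, h0, zero_sub, neg_ne_zero]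
        exact hA
      obtain ⟨i', -, h2⟩ := exists_of_boundary_ne_zero h1
      have h3 : insert i' A ∉ supComplex m (LowerSet.Iic μ) := fun hmem =>
        h2 (by rw [Pi.sub_apply, hR, restrict_apply_of_mem hmem, sub_self])
      rw [Pi.sub_apply, hR, restrict_apply_of_notMem h3, sub_zero] at h2
      have h4 : μ ≤ (insert i' A).sup m := hAμ ▸ Finset.sup_mono (Finset.subset_insert i' A)
      exact hmaxY _ (sup_mem_lcmLattice m _) (hc _ h2).1 (lt_of_le_of_ne h4 fun h5 => h3 h5.ge)
    obtain ⟨w, hw, e, he, hwe⟩ := exists_of_not_isBetti hm hμL (hB μ hμY hμZ) hRc hdR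
    have hIic : supComplex m (LowerSet.Iic μ) ≤ supComplex m Y := fun A hA => Y.lower hA hμY
    -- What remains consists of the faces of `c` whose lcm does not divide `μ`, none of which has
    -- lcm a multiple of `μ`, and of a chain of `Delta m μ`.
    have hc' : c - boundary k w ∈ chains k (supComplex m Y') j := by
      have : c - boundary k w = (c - R c) + e := by rw [hwe]; abel
      rw [this]
      refine add_mem (fun A hA => ?_) fun A hA => ?_
      · have h3 : A ∉ supComplex m (LowerSet.Iic μ) := fun hmem =>
          hA (by rw [Pi.sub_apply, hR, restrict_apply_of_mem hmem, sub_self])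
        rw [Pi.sub_apply, hR, restrict_apply_of_notMem h3, sub_zero] at hA
        refine ⟨⟨(hc A hA).1, fun h => ?_⟩, (hc A hA).2⟩
        exact hmaxY _ (sup_mem_lcmLattice m _) (hc _ hA).1 (lt_of_le_of_ne h fun h5 => h3 h5.ge)
      · have h := mem_Delta_iff.1 (he A hA).1
        exact ⟨⟨Y.lower h.le hμY, h.not_ge⟩, (he A hA).2⟩
    obtain ⟨w', hw', e', he', h'⟩ := ih Y' hcard hZY' (fun γ hγ => hB γ hγ.1) _ hc' (by
      rw [map_sub, boundary_boundary, sub_zero]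
      exact hd)
    refine ⟨w + w', add_mem (chains_mono hIic _ hw) (chains_mono (supComplex_mono hY'Y) _ hw'),
      e', he', ?_⟩
    rw [map_add, add_assoc, ← h']
    abel

end Chains

/-! ### Homology classes of chains -/

section HasClass

variable {k : Type u} [Field k] {r : ℕ}

/-- The chain `z` is a cycle of `Δ` with homology class `ξ`. -/
def HasClass (Δ : Complex r) (q : ℕ) (z : Chain k r) (ξ : Homology k Δ q) : Prop :=
  ∃ h : z ∈ cycles k Δ q, homologyClass k Δ q ⟨z, h⟩ = ξ

variable {Δ Δ' : Complex r} {q : ℕ} {z z' : Chain k r} {ξ ξ' : Homology k Δ q}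

theorem exists_hasClass (ξ : Homology k Δ q) : ∃ z, HasClass Δ q z ξ := by
  obtain ⟨⟨z, hz⟩, h⟩ := homologyClass_surjective k Δ q ξ
  exact ⟨z, hz, h⟩

theorem HasClass.eq (h : HasClass Δ q z ξ) (h' : HasClass Δ q z ξ') : ξ = ξ' := by
  obtain ⟨_, rfl⟩ := h
  obtain ⟨_, rfl⟩ := h'
  rfl

theorem HasClass.add (h : HasClass Δ q z ξ) (h' : HasClass Δ q z' ξ') :
    HasClass Δ q (z + z') (ξ + ξ') := by
  obtain ⟨hz, rfl⟩ := h
  obtain ⟨hz', rfl⟩ := h'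
  exact ⟨add_mem hz hz', map_add (homologyClass k Δ q) ⟨z, hz⟩ ⟨z', hz'⟩⟩

theorem HasClass.neg (h : HasClass Δ q z ξ) : HasClass Δ q (-z) (-ξ) := by
  obtain ⟨hz, rfl⟩ := h
  exact ⟨neg_mem hz, map_neg (homologyClass k Δ q) ⟨z, hz⟩⟩

theorem HasClass.of_boundary {e : Chain k r} (he : e ∈ chains k Δ (q + 1)) :
    HasClass Δ q (boundary k e) 0 :=
  ⟨⟨boundary_mem_chains he, boundary_boundary k e⟩,
    (homologyClass_eq_zero_iff k _).2 (Submodule.mem_map_of_mem he)⟩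

theorem HasClass.exists_boundary (h : HasClass Δ q z (0 : Homology k Δ q)) :
    ∃ e ∈ chains k Δ (q + 1), boundary k e = z := by
  obtain ⟨hz, h⟩ := h
  exact (homologyClass_eq_zero_iff k _).1 h

theorem HasClass.map (hΔ : Δ ≤ Δ') (h : HasClass Δ q z ξ) :
    HasClass Δ' q z (homologyMap hΔ q ξ) := by
  obtain ⟨hz, rfl⟩ := h
  exact ⟨cycles_mono hΔ q hz, rfl⟩

theorem HasClass.mayerVietoris {ξ : Homology k (Δ ⊔ Δ') (q + 1)}
    (h : HasClass (Δ ⊔ Δ') (q + 1) z ξ) :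
    HasClass (Δ ⊓ Δ') q (boundary k (restrict Δ z)) (mayerVietoris Δ Δ' q ξ) := by
  obtain ⟨hz, rfl⟩ := h
  exact ⟨(connectingCycles Δ Δ' q ⟨z, hz⟩).2, rfl⟩

end HasClass

/-! ### The Betti poset and its grading -/

section Betti

variable {k : Type u} [Field k] {n r : ℕ} {m : Fin r → (Fin n →₀ ℕ)}

theorem nontrivial_totalHomology_iff {Δ : Complex r} :
    Nontrivial (TotalHomology k Δ) ↔ ∃ q, Nontrivial (Homology k Δ q) := by
  constructor
  · intro h
    by_contra! h'
    obtain ⟨x, y, hxy⟩ := h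
    exact hxy (DFinsupp.ext fun q => Subsingleton.elim _ _)
  · rintro ⟨q, h⟩
    exact (DirectSum.of_injective (β := fun q => Homology k Δ q) q).nontrivial

theorem mem_bettiPoset_iff {μ : Fin n →₀ ℕ} : μ ∈ bettiPoset m k ↔ ∃ i, IsBetti k m i μ := by
  constructor
  · rintro ⟨h1, h2⟩
    by_cases h0 : μ = 0
    · exact ⟨0, h0⟩
    · obtain ⟨q, hq⟩ := nontrivial_totalHomology_iff.1 (h2.resolve_left h0)
      exact ⟨q + 1, Finset.mem_erase.2 ⟨h0, h1⟩, hq⟩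
  · rintro ⟨_ | q, h⟩
    · exact ⟨h.mem_lcmLattice, Or.inl h⟩
    · exact ⟨h.mem_lcmLattice, Or.inr (nontrivial_totalHomology_iff.2 ⟨q, h.2⟩)⟩

variable (m) in
/-- The monomials dividing an element of the Betti poset strictly below `μ`. -/
def closureBettiBelow (k : Type u) [Field k] (μ : Fin n →₀ ℕ) : LowerSet (Fin n →₀ ℕ) :=
  lowerClosure (bettiBelow m k μ)

theorem exists_le_maxBettiBelow {μ β : Fin n →₀ ℕ} (hβ : β ∈ bettiBelow m k μ) :
    ∃ γ ∈ maxBettiBelow m k μ, β ≤ γ := by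
  have hfin : (bettiBelow m k μ).Finite :=
    (lcmLattice m).finite_toSet.subset fun γ hγ => hγ.1.1
  obtain ⟨γ, h1, h2⟩ := hfin.exists_le_maximal hβ
  exact ⟨γ, h2, h1⟩

/-- The Betti poset is finite, so generating by its maximal elements below `μ` or by all of them
gives the same faces. -/
theorem tildeDelta_eq (μ : Fin n →₀ ℕ) :
    tildeDelta m k μ = supComplex m (closureBettiBelow m k μ) := by
  ext A
  simp only [SetLike.mem_coe, mem_supComplex, closureBettiBelow, tildeDelta, mem_lowerClosure]
  constructor
  · rintro ⟨_, ⟨β, hβ, rfl⟩, hle⟩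
    exact ⟨β, hβ.prop, (subset_atomsBelow_iff m).1 hle⟩
  · rintro ⟨β, hβ, hle⟩
    obtain ⟨γ, hγ, h⟩ := exists_le_maxBettiBelow hβ
    exact ⟨_, ⟨γ, hγ, rfl⟩, (subset_atomsBelow_iff m).2 (hle.trans h)⟩

/-- Every Betti element strictly below `μ` lies in the smaller order ideal, so the pair has no
relative homology in any degree. -/
theorem exists_boundary_add_tildeDelta (hm : ∀ i, m i ≠ 0) (μ : Fin n →₀ ℕ) {j : ℕ}
    {c : Chain k r} (hc : c ∈ chains k (Delta m μ) j)
    (hd : ∀ A, boundary k c A ≠ 0 → A ∈ tildeDelta m k μ) :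
    ∃ w ∈ chains k (Delta m μ) (j + 1), ∃ e ∈ chains k (tildeDelta m k μ) j,
      c = boundary k w + e := by
  rw [tildeDelta_eq] at *
  rw [Delta_eq] at *
  refine exists_boundary_add hm ?_ (fun γ hγ hγ' hB => hγ' ?_) hc hd
  · intro γ hγ
    obtain ⟨β, hβ, h⟩ := mem_lowerClosure.1 hγ
    exact h.trans_lt hβ.2
  · exact subset_lowerClosure ⟨mem_bettiPoset_iff.2 ⟨j, hB⟩, hγ⟩

/-- Both halves are vanishing of relative homology: applied to a filling it gives injectivity,
applied to a cycle surjectivity. Rigidity plays no role. -/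
theorem sigmaMap_bijective (hm : ∀ i, m i ≠ 0) (μ : Fin n →₀ ℕ) (q : ℕ) :
    Function.Bijective (sigmaMap m k μ q) := by
  constructor
  · rw [← LinearMap.ker_eq_bot, LinearMap.ker_eq_bot']
    intro ξ hξ
    obtain ⟨z, hz⟩ := exists_hasClass ξ
    have h := hz.map (tildeDelta_le m k μ)
    rw [show homologyMap (tildeDelta_le m k μ) q ξ = 0 from hξ] at h
    obtain ⟨e, he, rfl⟩ := h.exists_boundary
    obtain ⟨w, -, e', he', rfl⟩ := exists_boundary_add_tildeDelta hm μ he fun A hA =>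
      (hz.1.1 A hA).1
    rw [map_add, boundary_boundary, zero_add] at hz
    exact hz.eq (HasClass.of_boundary he')
  · intro ξ
    obtain ⟨z, hz⟩ := exists_hasClass ξ
    obtain ⟨w, hw, e, he, rfl⟩ := exists_boundary_add_tildeDelta hm μ hz.1.1 fun A hA =>
      absurd (congrFun hz.1.2 A) hA
    have hde : boundary k e = 0 := by
      have h : boundary k (boundary k w + e) = 0 := hz.1.2
      rwa [map_add, boundary_boundary, zero_add] at h
    have h1 : HasClass (tildeDelta m k μ) q e (homologyClass k _ q ⟨e, he, hde⟩) := ⟨_, rfl⟩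
    refine ⟨homologyClass k _ q ⟨e, he, hde⟩, ?_⟩
    have h2 := (HasClass.of_boundary hw).add (h1.map (tildeDelta_le m k μ))
    rw [zero_add] at h2
    exact h2.eq hz

theorem HasClass.sigmaInv (hm : ∀ i, m i ≠ 0) {μ : Fin n →₀ ℕ} {q : ℕ} {z : Chain k r}
    {ξ : Homology k (Delta m μ) q} (hξ : HasClass (Delta m μ) q z ξ)
    (hz : z ∈ cycles k (tildeDelta m k μ) q) :
    HasClass (tildeDelta m k μ) q z (sigmaInv m k μ q ξ) := by
  have hb := sigmaMap_bijective (k := k) hm μ q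
  refine ⟨hz, ?_⟩
  rw [MonomialResolution.sigmaInv, dif_pos hb, LinearEquiv.coe_coe, LinearEquiv.eq_symm_apply]
  have h1 : HasClass (tildeDelta m k μ) q z (homologyClass k _ q ⟨z, hz⟩) := ⟨_, rfl⟩
  exact (h1.map (tildeDelta_le m k μ)).eq hξ

theorem exists_hasClass_tildeDelta (hm : ∀ i, m i ≠ 0) {μ : Fin n →₀ ℕ} {q : ℕ}
    (ξ : Homology k (Delta m μ) q) :
    ∃ z ∈ cycles k (tildeDelta m k μ) q, HasClass (Delta m μ) q z ξ := by
  obtain ⟨ξ', rfl⟩ := (sigmaMap_bijective (k := k) hm μ q).2 ξ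
  obtain ⟨z, hz⟩ := exists_hasClass ξ'
  exact ⟨z, hz.1, hz.map (tildeDelta_le m k μ)⟩

variable (m k) in
/-- The degrees in which elements of the Betti poset occur form a strictly monotonic function. -/
structure IsBettiGraded : Prop where
  ne_zero : ∀ i, m i ≠ 0
  lt_of_lt : ∀ {i j : ℕ} {β μ : Fin n →₀ ℕ}, IsBetti k m i β → IsBetti k m j μ → β < μ → i < j
  unique : ∀ {i j : ℕ} {μ : Fin n →₀ ℕ}, IsBetti k m i μ → IsBetti k m j μ → i = j

theorem eq_of_nontrivial_of_totalHomology_equiv {Δ : Complex r}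
    (e : TotalHomology k Δ ≃ₗ[k] k) {p q : ℕ} (hp : Nontrivial (Homology k Δ p))
    (hq : Nontrivial (Homology k Δ q)) : p = q := by
  by_contra hpq
  obtain ⟨x, hx⟩ := exists_ne (0 : Homology k Δ p)
  obtain ⟨y, hy⟩ := exists_ne (0 : Homology k Δ q)
  set X := DirectSum.lof k ℕ (fun q => Homology k Δ q) p x with hX
  set Y := DirectSum.lof k ℕ (fun q => Homology k Δ q) q y with hY
  -- Two vectors of a one-dimensional space are proportional, while classes in different dimensions
  -- are independent.
  have h : e Y • X = e X • Y := by
    apply e.injective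
    rw [map_smul, map_smul, smul_eq_mul, smul_eq_mul, mul_comm]
  have h1 := congrArg (DirectSum.component k ℕ (fun q => Homology k Δ q) p) h
  rw [map_smul, map_smul, hX, DirectSum.component.lof_self, hY, DirectSum.component.of,
    dif_neg (Ne.symm hpq), smul_zero, smul_eq_zero, ← hY] at h1
  rcases h1 with h1 | h1
  · have h2 : Y = 0 := e.injective (h1.trans (map_zero e).symm)
    have h3 := congrArg (DirectSum.component k ℕ (fun q => Homology k Δ q) q) h2
    rw [hY, DirectSum.component.lof_self, map_zero] at h3
    exact hy h3
  · exact hx h1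

/-- Condition (i) gives monotonicity, and condition (ii) enters through concentration of the
homology in one dimension. The bottom element has degree `0` and all others have positive degree. -/
theorem IsRigid.isBettiGraded (hm : ∀ i, m i ≠ 0) (h : IsRigid m k) : IsBettiGraded k m where
  ne_zero := hm
  lt_of_lt := by
    rintro (_ | i) (_ | j) β μ hβ hμ hlt
    · rw [show β = 0 from hβ, show μ = 0 from hμ] at hlt
      exact absurd hlt (lt_irrefl 0)
    · exact Nat.succ_pos j
    · rw [show μ = 0 from hμ] at hlt
      exact absurd hlt not_lt_bot
    · exact Nat.succ_lt_succ (h.1 β hβ.1 μ hμ.1 hlt i j hβ.2 hμ.2)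
  unique := by
    rintro (_ | i) (_ | j) μ hi hj
    · rfl
    · exact absurd hi (Finset.ne_of_mem_erase hj.1)
    · exact absurd hj (Finset.ne_of_mem_erase hi.1)
    · obtain ⟨e⟩ := h.2 μ (mem_bettiPoset_iff.2 ⟨_, hi⟩) (Finset.ne_of_mem_erase hi.1)
      rw [eq_of_nontrivial_of_totalHomology_equiv e hi.2 hj.2]

theorem IsBettiGraded.le_of_le (H : IsBettiGraded k m) {i j : ℕ} {β μ : Fin n →₀ ℕ}
    (hβ : IsBetti k m i β) (hμ : IsBetti k m j μ) (h : β ≤ μ) : i ≤ j := by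
  rcases h.lt_or_eq with h | rfl
  · exact (H.lt_of_lt hβ hμ h).le
  · exact (H.unique hβ hμ).le

end Betti

/-! ### The maps `phi` on summands -/

section Phi

variable {k : Type u} [Field k] {n r : ℕ} {m : Fin r → (Fin n →₀ ℕ)}

theorem projectionAt_inclusionAt_self (μ : lcmLattice' m) (q : ℕ) (y : Homology k (Delta m μ.1) q) :
    projectionAt m k μ q (inclusionAt m k μ q y) = y :=
  DirectSum.component.lof_self k (M := fun μ : lcmLattice' m => Homology k (Delta m μ.1) q) μ y

theorem projectionAt_inclusionAt_of_ne {μ β : lcmLattice' m} (h : μ ≠ β) (q : ℕ)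
    (y : Homology k (Delta m μ.1) q) : projectionAt m k β q (inclusionAt m k μ q y) = 0 :=
  (DirectSum.component.of k (M := fun μ : lcmLattice' m => Homology k (Delta m μ.1) q) β μ y).trans
    (dif_neg h)

theorem posetSpace_ext {q : ℕ} {x y : PosetSpace m k (q + 1)}
    (h : ∀ β, projectionAt m k β q x = projectionAt m k β q y) : x = y :=
  DirectSum.ext_component k (M := fun μ : lcmLattice' m => Homology k (Delta m μ.1) q) h

theorem projectionAt_sum_inclusionAt {q : ℕ}
    (y : ∀ μ : lcmLattice' m, Homology k (Delta m μ.1) q) (β : lcmLattice' m) :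
    projectionAt m k β q (∑ μ, inclusionAt m k μ q (y μ)) = y β := by
  rw [map_sum, Finset.sum_eq_single_of_mem β (Finset.mem_univ β), projectionAt_inclusionAt_self]
  exact fun μ _ hμ => projectionAt_inclusionAt_of_ne hμ q _

theorem sum_inclusionAt_projectionAt {q : ℕ} (x : PosetSpace m k (q + 1)) :
    ∑ μ, inclusionAt m k μ q (projectionAt m k μ q x) = x :=
  posetSpace_ext fun β => projectionAt_sum_inclusionAt _ β

theorem phi_zero_apply (x : PosetSpace m k 1) :
    phi m k 0 x = ∑ μ : lcmLattice' m, (phiOne m k μ.1 (projectionAt m k μ 0 x) :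
      Homology k (pointComplex r) 0) := by
  exact LinearMap.sum_apply Finset.univ (fun μ : lcmLattice' m =>
    (phiOne m k μ.1 ∘ₗ projectionAt m k μ 0 :
      PosetSpace m k 1 →ₗ[k] Homology k (pointComplex r) 0)) x

theorem phi_zero_inclusionAt (μ : lcmLattice' m) (y : Homology k (Delta m μ.1) 0) :
    phi m k 0 (inclusionAt m k μ 0 y) = phiOne m k μ.1 y := by
  rw [phi_zero_apply]
  refine (Finset.sum_eq_single_of_mem μ (Finset.mem_univ μ) fun β _ hβ => ?_).trans
    (by rw [projectionAt_inclusionAt_self])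
  rw [projectionAt_inclusionAt_of_ne hβ.symm]
  exact map_zero _

theorem projectionAt_phi (q : ℕ) (x : PosetSpace m k (q + 2)) (β : lcmLattice' m) :
    projectionAt m k β q (phi m k (q + 1) x) =
      ∑ μ : lcmLattice' m, phiComponent m k μ.1 β.1 q (projectionAt m k μ (q + 1) x) := by
  rw [phi, LinearMap.sum_apply, map_sum]
  refine Finset.sum_congr rfl fun μ _ => ?_
  rw [LinearMap.sum_apply]
  exact projectionAt_sum_inclusionAt
    (fun β : lcmLattice' m => phiComponent m k μ.1 β.1 q (projectionAt m k μ (q + 1) x)) β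

theorem projectionAt_phi_inclusionAt (q : ℕ) (μ β : lcmLattice' m)
    (y : Homology k (Delta m μ.1) (q + 1)) :
    projectionAt m k β q (phi m k (q + 1) (inclusionAt m k μ (q + 1) y)) =
      phiComponent m k μ.1 β.1 q y := by
  rw [projectionAt_phi, Finset.sum_eq_single_of_mem μ (Finset.mem_univ μ),
    projectionAt_inclusionAt_self]
  intro γ _ hγ
  rw [projectionAt_inclusionAt_of_ne hγ.symm, map_zero]

theorem phiComponent_eq_zero {μ β : Fin n →₀ ℕ} (h : ¬β < μ) (q : ℕ) :
    phiComponent m k μ β q = 0 :=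
  dif_neg fun hβ => h hβ.prop.2

end Phi

/-! ### Chains representing elements of the poset construction -/

section Cells

variable {k : Type u} [Field k] {n r : ℕ} {m : Fin r → (Fin n →₀ ℕ)}

variable (k m) in
/-- The divisors of elements of the Betti poset of degree at most `i` which divide `α`. -/
def stage (i : ℕ) (α : Fin n →₀ ℕ) : LowerSet (Fin n →₀ ℕ) :=
  lowerClosure {β | ∃ j ≤ i, IsBetti k m j β ∧ β ≤ α}

theorem stage_mono {i j : ℕ} (h : i ≤ j) (α : Fin n →₀ ℕ) : stage k m i α ≤ stage k m j α :=
  lowerClosure_mono fun _ ⟨l, hl, hβ⟩ => ⟨l, hl.trans h, hβ⟩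

theorem IsBetti.mem_stage {i j : ℕ} {α β : Fin n →₀ ℕ} (hβ : IsBetti k m j β) (h : j ≤ i)
    (hα : β ≤ α) : β ∈ stage k m i α :=
  subset_lowerClosure ⟨j, h, hβ, hα⟩

theorem stage_le_Iic (i : ℕ) (α : Fin n →₀ ℕ) : stage k m i α ≤ LowerSet.Iic α := by
  intro γ hγ
  obtain ⟨β, ⟨_, _, _, hβ⟩, h⟩ := mem_lowerClosure.1 hγ
  exact h.trans hβ

theorem IsBettiGraded.not_isBetti_of_mem_stage (H : IsBettiGraded k m) {i j : ℕ} (hij : i < j)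
    {α β : Fin n →₀ ℕ} (h : β ∈ stage k m i α) : ¬IsBetti k m j β := by
  intro hβ
  obtain ⟨γ, ⟨l, hl, hγ, _⟩, hle⟩ := mem_lowerClosure.1 h
  exact absurd (H.le_of_le hβ hγ hle) (by omega)

theorem IsBettiGraded.not_lt_of_mem_stage (H : IsBettiGraded k m) {i : ℕ}
    {α β γ : Fin n →₀ ℕ} (hβ : IsBetti k m i β) (h : γ ∈ stage k m i α) : ¬β < γ := by
  intro hlt
  obtain ⟨δ, ⟨l, hl, hδ, _⟩, hle⟩ := mem_lowerClosure.1 h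
  exact absurd (H.lt_of_lt hβ hδ (hlt.trans_le hle)) (by omega)

/-- The chain `c` represents the element `x` of `𝓓_i`: for every Betti degree `β` of homological
degree `i` the boundary of the part of `c` supported on divisors of `β` has as its class in the
homology of `Δ_β` the component of `x` at `β`. -/
def Represents : ∀ i, Chain k r → PosetSpace m k i → Prop
  | 0, c, x => HasClass (pointComplex r) 0 c x
  | q + 1, c, x => ∀ β : lcmLattice' m, IsBetti k m (q + 1) β.1 →
      HasClass (Delta m β.1) q (boundary k (restrict (supComplex m (LowerSet.Iic β.1)) c))
        (projectionAt m k β q x)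

theorem Represents.add {i : ℕ} {c c' : Chain k r} {x x' : PosetSpace m k i}
    (h : Represents i c x) (h' : Represents i c' x') : Represents i (c + c') (x + x') := by
  cases i with
  | zero => exact HasClass.add h h'
  | succ q =>
    intro β hβ
    rw [map_add, map_add, map_add]
    exact (h β hβ).add (h' β hβ)

theorem Represents.neg {i : ℕ} {c : Chain k r} {x : PosetSpace m k i}
    (h : Represents i c x) : Represents i (-c) (-x) := by
  cases i with
  | zero => exact HasClass.neg h
  | succ q =>
    intro β hβ
    rw [map_neg, map_neg, map_neg]
    exact (h β hβ).neg

theorem Represents.sub {i : ℕ} {c c' : Chain k r} {x x' : PosetSpace m k i}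
    (h : Represents i c x) (h' : Represents i c' x') : Represents i (c - c') (x - x') := by
  rw [sub_eq_add_neg, sub_eq_add_neg]
  exact h.add h'.neg

theorem represents_zero (i : ℕ) : Represents i (0 : Chain k r) (0 : PosetSpace m k i) := by
  cases i with
  | zero => exact ⟨zero_mem _, map_zero (homologyClass k (pointComplex r) 0)⟩
  | succ q =>
    intro β _
    rw [map_zero, map_zero, map_zero]
    exact ⟨zero_mem _, map_zero (homologyClass k _ q)⟩

theorem projectionAt_eq_zero {q : ℕ} {β : lcmLattice' m} (hβ : ¬IsBetti k m (q + 1) β.1)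
    (x : PosetSpace m k (q + 1)) : projectionAt m k β q x = 0 := by
  have : ¬Nontrivial (Homology k (Delta m β.1) q) := fun h => hβ ⟨β.2, h⟩
  rw [not_nontrivial_iff_subsingleton] at this
  exact Subsingleton.elim _ _

/-- The summands on which `Represents` imposes nothing are zero. -/
theorem Represents.eq {i : ℕ} {c : Chain k r} {x x' : PosetSpace m k i}
    (h : Represents i c x) (h' : Represents i c x') : x = x' := by
  cases i with
  | zero => exact HasClass.eq h h'
  | succ q =>
    refine posetSpace_ext fun β => ?_
    by_cases hβ : IsBetti k m (q + 1) β.1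
    · exact (h β hβ).eq (h' β hβ)
    · rw [projectionAt_eq_zero hβ, projectionAt_eq_zero hβ]

/-! ### Relative cycles of the filtration and the elements they represent -/

/-- No face of `c` has lcm exactly `β`, so a face with lcm dividing `β` has lcm strictly below it.
-/
theorem restrict_mem_Delta {Y : LowerSet (Fin n →₀ ℕ)} {β : Fin n →₀ ℕ} (hβ : β ∉ Y) {q : ℕ}
    {c : Chain k r} (hc : c ∈ chains k (supComplex m Y) q) :
    restrict (supComplex m (LowerSet.Iic β)) c ∈ chains k (Delta m β) q := by
  intro A hA
  obtain ⟨h1, h2⟩ := restrict_apply_ne_zero hA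
  refine ⟨mem_Delta_iff.2 (lt_of_le_of_ne h1 fun h => hβ ?_), (hc A h2).2⟩
  rw [← h]
  exact (hc A h2).1

theorem represents_zero_of_mem {Y : LowerSet (Fin n →₀ ℕ)} {q : ℕ}
    (hY : ∀ β ∈ Y, ¬IsBetti k m (q + 1) β) {c : Chain k r}
    (hc : c ∈ chains k (supComplex m Y) (q + 1)) :
    Represents (q + 1) c (0 : PosetSpace m k (q + 1)) := by
  intro β hβ
  rw [map_zero]
  exact HasClass.of_boundary (restrict_mem_Delta (fun h => hY _ h hβ) hc)

theorem IsBettiGraded.represents_zero_of_mem_stage (H : IsBettiGraded k m) {q : ℕ} {α : Fin n →₀ ℕ}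
    {c : Chain k r} (hc : c ∈ chains k (supComplex m (stage k m q α)) (q + 1)) :
    Represents (q + 1) c (0 : PosetSpace m k (q + 1)) :=
  represents_zero_of_mem (fun _ h => H.not_isBetti_of_mem_stage q.lt_succ_self h) hc

theorem IsBettiGraded.eq_zero_of_mem_stage_zero (H : IsBettiGraded k m) {q : ℕ}
    {α : Fin n →₀ ℕ} {c : Chain k r}
    (hc : c ∈ chains k (supComplex m (stage k m 0 α)) (q + 1)) : c = 0 := by
  ext A
  by_contra hA
  obtain ⟨h1, h2⟩ := hc A hA
  obtain ⟨i, hi⟩ : A.Nonempty := Finset.card_pos.1 (by omega)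
  obtain ⟨β, ⟨j, hj, hβ, -⟩, hle⟩ := mem_lowerClosure.1 h1
  rw [Nat.le_zero.1 hj] at hβ
  rw [show β = 0 from hβ] at hle
  exact H.ne_zero i (le_bot_iff.1 ((Finset.le_sup hi).trans hle))

/-- Restriction to the divisors of `β` commutes with the boundary modulo chains of `Delta m β`,
because `β` is maximal in the stage. Taking boundaries once more leaves a boundary of `Delta m β`.
-/
theorem IsBettiGraded.represents_zero_of_boundary (H : IsBettiGraded k m) {i : ℕ}
    {α : Fin n →₀ ℕ} {w : Chain k r} (hw : w ∈ chains k (supComplex m (stage k m i α)) (i + 1)) :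
    Represents i (boundary k w) (0 : PosetSpace m k i) := by
  cases i with
  | zero =>
    rw [H.eq_zero_of_mem_stage_zero hw, map_zero]
    exact represents_zero 0
  | succ q =>
    intro β hβ
    have h := restrict_boundary_sub_mem (fun γ hγ => H.not_lt_of_mem_stage hβ hγ) hw
    have h' := HasClass.of_boundary h
    rw [map_sub, boundary_boundary, sub_zero] at h'
    rw [map_zero]
    exact h'

/-- The restriction of `boundary k c` lies in `Delta m β` since `β` is not in stage `q`. It agrees
with the boundary of the restriction modulo `Delta m β`, so the latter is a cycle there, and its
class is the component at `β`. -/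
theorem IsBettiGraded.exists_represents (H : IsBettiGraded k m) {q : ℕ} {α : Fin n →₀ ℕ}
    {c : Chain k r} (hc : c ∈ chains k (supComplex m (stage k m (q + 1) α)) (q + 1))
    (hd : boundary k c ∈ chains k (supComplex m (stage k m q α)) q) :
    ∃ x : PosetSpace m k (q + 1), Represents (q + 1) c x ∧
      ∀ β : lcmLattice' m, ¬β.1 ≤ α → projectionAt m k β q x = 0 := by
  have key : ∀ β : lcmLattice' m, ∃ ξ : Homology k (Delta m β.1) q,
      IsBetti k m (q + 1) β.1 →
        HasClass (Delta m β.1) q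
          (boundary k (restrict (supComplex m (LowerSet.Iic β.1)) c)) ξ := by
    intro β
    by_cases hβ : IsBetti k m (q + 1) β.1
    · have h := restrict_boundary_sub_mem (fun γ hγ => H.not_lt_of_mem_stage hβ hγ) hc
      have h' := sub_mem (restrict_mem_Delta
        (fun h => H.not_isBetti_of_mem_stage q.lt_succ_self h hβ) hd) h
      rw [sub_sub_cancel] at h'
      exact ⟨_, fun _ => ⟨⟨h', boundary_boundary k _⟩, rfl⟩⟩
    · exact ⟨0, fun h => absurd h hβ⟩
  choose ξ hξ using key
  refine ⟨∑ β, inclusionAt m k β q (ξ β), fun β hβ => ?_, fun β hβ => ?_⟩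
  · rw [projectionAt_sum_inclusionAt]
    exact hξ β hβ
  · by_cases hB : IsBetti k m (q + 1) β.1
    · rw [projectionAt_sum_inclusionAt]
      exact (hξ β hB).eq (HasClass.of_boundary
        (restrict_mem_Delta (fun h => hβ (stage_le_Iic _ _ h)) hc))
    · exact projectionAt_eq_zero hB _

/-- A vertex of `Delta m μ` would bound the empty face and kill the homology in dimension `-1`. -/
theorem IsBetti.Delta_eq_pointComplex {μ : Fin n →₀ ℕ}
    (hμ : IsBetti k m 1 μ) : Delta m μ = pointComplex r := by
  ext A
  simp only [SetLike.mem_coe, mem_Delta_iff, mem_lowerClosure, Set.mem_singleton_iff,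
    exists_eq_left, Finset.subset_empty]
  constructor
  · intro hA
    by_contra h0
    obtain ⟨i, hi⟩ := Finset.nonempty_iff_ne_empty.2 h0
    have hlt : m i < μ := (Finset.le_sup hi).trans_lt hA
    obtain ⟨ξ, hξ⟩ := @exists_ne _ hμ.2 (0 : Homology k (Delta m μ) 0)
    obtain ⟨z, hz⟩ := exists_hasClass ξ
    have hz' : z ∈ chains k (supComplex m (LowerSet.Iic (m i))) 0 := fun A hA => by
      have h := (hz.1.1 A hA).2
      refine ⟨?_, h⟩
      rw [Finset.card_eq_zero.1 h, mem_supComplex, Finset.sup_empty]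
      exact (bot_le : (⊥ : Fin n →₀ ℕ) ≤ m i)
    obtain ⟨w, hw, rfl⟩ := exists_boundary_eq_of_cycle le_rfl hz' hz.1.2
    refine hξ (hz.eq (HasClass.of_boundary (chains_mono (fun A hA => ?_) _ hw)))
    exact mem_Delta_iff.2 (lt_of_le_of_lt hA hlt)
  · rintro rfl
    rw [Finset.sup_empty]
    exact bot_lt_iff_ne_bot.2 (Finset.ne_of_mem_erase hμ.1)

/-- The cell is a filling, in the simplex below `μ`, of a cycle of `tildeDelta` in the class `y`.
Restricting that cycle to the divisors of `β` and taking the boundary is the chain-level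
Mayer-Vietoris connecting map, so the boundary of the cell represents `phi`. -/
theorem IsBettiGraded.exists_cell_inclusionAt (H : IsBettiGraded k m) {q : ℕ}
    {α : Fin n →₀ ℕ} {μ : lcmLattice' m} (hμ : IsBetti k m (q + 1) μ.1) (hα : μ.1 ≤ α)
    (y : Homology k (Delta m μ.1) q) :
    ∃ c ∈ chains k (supComplex m (stage k m (q + 1) α)) (q + 1),
      boundary k c ∈ chains k (supComplex m (stage k m q α)) q ∧
      Represents (q + 1) c (inclusionAt m k μ q y) ∧
      Represents q (boundary k c) (phi m k q (inclusionAt m k μ q y)) := by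
  obtain ⟨z, hz, hzy⟩ := exists_hasClass_tildeDelta H.ne_zero y
  have hle : Delta m μ.1 ≤ supComplex m (LowerSet.Iic μ.1) := fun A hA => (mem_Delta_iff.1 hA).le
  obtain ⟨i, hi⟩ := exists_le_of_mem_lcmLattice hμ.mem_lcmLattice (Finset.ne_of_mem_erase μ.2)
  obtain ⟨c, hc, rfl⟩ := exists_boundary_eq_of_cycle hi (chains_mono hle _ hzy.1.1) hz.2
  refine ⟨c, chains_mono (supComplex_mono ?_) _ hc, chains_mono ?_ _ hz.1, ?_, ?_⟩
  · exact fun γ hγ => (stage k m (q + 1) α).lower hγ (hμ.mem_stage le_rfl hα)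
  · rw [tildeDelta_eq]
    refine supComplex_mono fun γ hγ => ?_
    obtain ⟨β, ⟨hβ, hβμ⟩, h⟩ := mem_lowerClosure.1 hγ
    obtain ⟨j, hj⟩ := mem_bettiPoset_iff.1 hβ
    exact (stage k m q α).lower h
      (hj.mem_stage (Nat.lt_succ_iff.1 (H.lt_of_lt hj hμ hβμ)) (hβμ.le.trans hα))
  · intro β hβ
    by_cases h : μ = β
    · subst h
      rw [projectionAt_inclusionAt_self, restrict_eq_self hc]
      exact hzy
    · rw [projectionAt_inclusionAt_of_ne h]
      refine HasClass.of_boundary (restrict_mem_Delta (fun h' => ?_) hc)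
      have h1 : β.1 < μ.1 := lt_of_le_of_ne h' fun h2 => h (Subtype.ext h2.symm)
      exact lt_irrefl _ (H.lt_of_lt hβ hμ h1)
  · cases q with
    | zero =>
      rw [phi_zero_inclusionAt, phiOne, dif_pos (hμ.Delta_eq_pointComplex)]
      exact hzy.map _
    | succ p =>
      intro β hβ
      rw [projectionAt_phi_inclusionAt]
      by_cases h : β.1 ∈ maxBettiBelow m k μ.1
      · rw [phiComponent, dif_pos h]
        have h1 := ((hzy.sigmaInv H.ne_zero hz).map
          (tildeDelta_le_sup m k μ.1 β.1)).mayerVietoris.map (inf_restDelta_le m k h)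
        rw [← generated_atomsBelow]
        exact h1
      · rw [phiComponent, dif_neg h]
        rw [tildeDelta_eq] at hz
        -- If `β` divided a Betti element strictly below `μ`, it would be maximal among these: the
        -- degrees of `β` and `μ` are consecutive, which leaves no Betti element strictly between
        -- them. So `β` is outside the order ideal, and its component is zero.
        refine HasClass.of_boundary (restrict_mem_Delta (fun h' => h ?_) hz.1)
        obtain ⟨γ, ⟨hγ, hγμ⟩, hle⟩ := mem_lowerClosure.1 h'
        refine ⟨⟨mem_bettiPoset_iff.2 ⟨_, hβ⟩, lt_of_le_of_lt hle hγμ⟩, ?_⟩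
        rintro δ ⟨hδ, hδμ⟩ hβδ
        obtain ⟨j, hj⟩ := mem_bettiPoset_iff.1 hδ
        have h1 := H.lt_of_lt hj hμ hδμ
        by_contra h2
        have h3 := H.lt_of_lt hβ hj (lt_of_le_not_ge hβδ h2)
        omega

theorem IsBettiGraded.exists_cell (H : IsBettiGraded k m) {q : ℕ} {α : Fin n →₀ ℕ}
    {x : PosetSpace m k (q + 1)}
    (hx : ∀ β : lcmLattice' m, ¬β.1 ≤ α → projectionAt m k β q x = 0) :
    ∃ c ∈ chains k (supComplex m (stage k m (q + 1) α)) (q + 1),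
      boundary k c ∈ chains k (supComplex m (stage k m q α)) q ∧
      Represents (q + 1) c x ∧ Represents q (boundary k c) (phi m k q x) := by
  rw [← sum_inclusionAt_projectionAt x]
  refine Finset.sum_induction _ (fun x =>
      ∃ c ∈ chains k (supComplex m (stage k m (q + 1) α)) (q + 1),
      boundary k c ∈ chains k (supComplex m (stage k m q α)) q ∧
      Represents (q + 1) c x ∧ Represents q (boundary k c) (phi m k q x)) ?_ ?_ ?_
  · rintro x y ⟨c, h1, h2, h3, h4⟩ ⟨c', h1', h2', h3', h4'⟩
    refine ⟨c + c', add_mem h1 h1', ?_, h3.add h3', ?_⟩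
    · rw [map_add]
      exact add_mem h2 h2'
    · rw [map_add, map_add]
      exact h4.add h4'
  · refine ⟨0, zero_mem _, ?_, represents_zero_of_mem (Y := ⊥) (fun _ h => h.elim) (zero_mem _), ?_⟩
    · rw [map_zero]
      exact zero_mem _
    · rw [map_zero, map_zero]
      exact represents_zero q
  · intro μ _
    by_cases hμ : IsBetti k m (q + 1) μ.1 ∧ μ.1 ≤ α
    · exact H.exists_cell_inclusionAt hμ.1 hμ.2 _
    · have h0 : projectionAt m k μ q x = 0 := by
        by_cases h : μ.1 ≤ α
        · exact projectionAt_eq_zero (fun h' => hμ ⟨h', h⟩) x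
        · exact hx μ h
      rw [h0, map_zero, map_zero]
      refine ⟨0, zero_mem _, ?_, represents_zero _, ?_⟩
      · rw [map_zero]
        exact zero_mem _
      · rw [map_zero]
        exact represents_zero q

/-- A relative cycle with all components zero is a relative boundary. Its part on the divisors of
each Betti element of degree `q + 1` is moved into `Delta` by a boundary; what is left avoids these
lcms, and the relative homology there vanishes. -/
theorem IsBettiGraded.exists_of_represents_zero (H : IsBettiGraded k m) {q : ℕ}
    {α : Fin n →₀ ℕ} {c : Chain k r}
    (hc : c ∈ chains k (supComplex m (stage k m (q + 1) α)) (q + 1))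
    (hd : boundary k c ∈ chains k (supComplex m (stage k m q α)) q)
    (h0 : Represents (q + 1) c (0 : PosetSpace m k (q + 1))) :
    ∃ w ∈ chains k (supComplex m (stage k m (q + 1) α)) (q + 2),
      ∃ e ∈ chains k (supComplex m (stage k m q α)) (q + 1), c = boundary k w + e := by
  classical
  set Y := stage k m (q + 1) α
  set R : (Fin n →₀ ℕ) → Chain k r →ₗ[k] Chain k r := fun β =>
    restrict (supComplex m (LowerSet.Iic β)) with hR
  let T : Finset (lcmLattice' m) :=
    Finset.univ.filter fun β => IsBetti k m (q + 1) β.1 ∧ β.1 ∈ Y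
  have key : ∀ β ∈ T, ∃ w ∈ chains k (supComplex m Y) (q + 2),
      ∃ e ∈ chains k (Delta m β.1) (q + 1), R β.1 c = boundary k w + e := by
    intro β hβ
    obtain ⟨-, hβ, hβY⟩ := Finset.mem_filter.1 hβ
    have h := h0 β hβ
    rw [map_zero] at h
    obtain ⟨e, he, hec⟩ := h.exists_boundary
    have hle : Delta m β.1 ≤ supComplex m (LowerSet.Iic β.1) :=
      fun A hA => (mem_Delta_iff.1 hA).le
    have hRc : R β.1 c ∈ chains k (supComplex m (LowerSet.Iic β.1)) (q + 1) := fun A hA =>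
      ⟨(restrict_apply_ne_zero hA).1, (hc A (restrict_apply_ne_zero hA).2).2⟩
    obtain ⟨i, hi⟩ := exists_le_of_mem_lcmLattice hβ.mem_lcmLattice (Finset.ne_of_mem_erase β.2)
    obtain ⟨w, hw, hwc⟩ := exists_boundary_eq_of_cycle hi
      (sub_mem hRc (chains_mono hle _ he)) (by rw [map_sub, hec, sub_self])
    exact ⟨w, chains_mono (supComplex_mono fun γ hγ => Y.lower hγ hβY) _ hw, e, he,
      by rw [hwc, sub_add_cancel]⟩
  choose! w hw e he hwe using key
  -- Removing the Betti elements of degree `q + 1` leaves an order ideal because nothing in `Y` lies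
  -- strictly above one of them.
  let V : LowerSet (Fin n →₀ ℕ) :=
    ⟨{γ | γ ∈ Y ∧ ¬IsBetti k m (q + 1) γ}, fun γ δ hδγ hγ => ⟨Y.lower hδγ hγ.1, fun hδ =>
      hγ.2 (by
        rcases hδγ.lt_or_eq with h | rfl
        · exact absurd h (H.not_lt_of_mem_stage hδ hγ.1)
        · exact hδ)⟩⟩
  have hVY : V ≤ Y := fun γ hγ => hγ.1
  have hqV : stage k m q α ≤ V := fun γ hγ =>
    ⟨stage_mono q.le_succ α hγ, H.not_isBetti_of_mem_stage q.lt_succ_self hγ⟩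
  have hsplit : c - ∑ β ∈ T, boundary k (w β) = (c - ∑ β ∈ T, R β.1 c) + ∑ β ∈ T, e β := by
    rw [Finset.sum_congr rfl hwe, Finset.sum_add_distrib]
    abel
  have hcV : c - ∑ β ∈ T, boundary k (w β) ∈ chains k (supComplex m V) (q + 1) := by
    rw [hsplit]
    refine add_mem (fun A hA => ?_) (sum_mem fun β hβ A hA => ?_)
    · have hcA : c A ≠ 0 := by
        intro h
        refine hA ?_
        rw [Pi.sub_apply, h, zero_sub, neg_eq_zero, Finset.sum_apply]
        refine Finset.sum_eq_zero fun β _ => ?_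
        by_contra h'
        exact (restrict_apply_ne_zero h').2 h
      refine ⟨⟨(hc A hcA).1, fun hB => hA ?_⟩, (hc A hcA).2⟩
      -- A face whose lcm is a Betti element of degree `q + 1` survives in exactly one restriction,
      -- since these elements are pairwise incomparable; its coefficient in the difference is
      -- therefore zero.
      have hmem : A.sup m ∈ lcmLattice' m := hB.1
      have hT : (⟨A.sup m, hmem⟩ : lcmLattice' m) ∈ T :=
        Finset.mem_filter.2 ⟨Finset.mem_univ _, hB, (hc A hcA).1⟩
      rw [Pi.sub_apply, Finset.sum_apply, Finset.sum_eq_single_of_mem _ hT, hR,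
        restrict_apply_of_mem
          (show A ∈ supComplex m (LowerSet.Iic (A.sup m)) from le_refl (A.sup m)),
        sub_self]
      intro β hβ hne
      refine restrict_apply_of_notMem (fun hA' => ?_) c
      have hlt : A.sup m < β.1 := lt_of_le_of_ne hA' fun h => hne (Subtype.ext h.symm)
      exact lt_irrefl _ (H.lt_of_lt hB (Finset.mem_filter.1 hβ).2.1 hlt)
    · have h := mem_Delta_iff.1 (he β hβ A hA).1
      obtain ⟨-, hβB, hβY⟩ := Finset.mem_filter.1 hβ
      exact ⟨⟨Y.lower h.le hβY, fun hB => lt_irrefl _ (H.lt_of_lt hB hβB h)⟩, (he β hβ A hA).2⟩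
  obtain ⟨w', hw', e', he', h⟩ := exists_boundary_add H.ne_zero hqV (fun γ hγ _ => hγ.2) hcV
    (by
      rw [map_sub, map_sum, Finset.sum_eq_zero fun β _ => boundary_boundary k _, sub_zero]
      exact fun A hA => (hd A hA).1)
  refine ⟨∑ β ∈ T, w β + w', add_mem (sum_mem hw) (chains_mono (supComplex_mono hVY) _ hw'),
    e', he', ?_⟩
  rw [map_add, map_sum, add_assoc, ← h]
  abel

/-! ### `phi` as the boundary map of the filtration, and exactness of strands -/

/-- The boundary of the standard cell for `x` represents `phi x`. Any other chain representing `x`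
differs from it by a boundary and a chain `e` of stage `q`, and the boundary of `e` represents zero.
-/
theorem IsBettiGraded.represents_phi (H : IsBettiGraded k m) {q : ℕ} {α : Fin n →₀ ℕ}
    {c : Chain k r} (hc : c ∈ chains k (supComplex m (stage k m (q + 1) α)) (q + 1))
    (hd : boundary k c ∈ chains k (supComplex m (stage k m q α)) q)
    {x : PosetSpace m k (q + 1)} (hx : Represents (q + 1) c x) :
    Represents q (boundary k c) (phi m k q x) := by
  obtain ⟨x', hx', hα⟩ := H.exists_represents hc hd
  obtain rfl := hx.eq hx'
  obtain ⟨c', hc', hd', h1, h2⟩ := H.exists_cell hα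
  have h3 := hx.sub h1
  rw [sub_self] at h3
  obtain ⟨w, -, e, he, h⟩ := H.exists_of_represents_zero (sub_mem hc hc')
    (by rw [map_sub]; exact sub_mem hd hd') h3
  have h4 : boundary k c = boundary k c' + boundary k e := by
    rw [← sub_eq_iff_eq_add', ← map_sub, h, map_add, boundary_boundary, zero_add]
  rw [h4, ← add_zero (phi m k q x)]
  exact h2.add (H.represents_zero_of_boundary he)

theorem IsBettiGraded.phi_phi (H : IsBettiGraded k m) (i : ℕ) (x : PosetSpace m k (i + 2)) :
    phi m k i (phi m k (i + 1) x) = 0 := by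
  -- With `α` the lcm of all generators the support condition is vacuous.
  obtain ⟨c, -, hd, -, h⟩ := H.exists_cell (α := Finset.univ.sup m) (x := x) fun β hβ =>
    absurd (by
      obtain ⟨A, -, hA⟩ := Finset.mem_image.1 (Finset.mem_of_mem_erase β.2)
      rw [← hA]
      exact Finset.sup_mono (Finset.subset_univ A)) hβ
  have h' := H.represents_phi hd (by rw [boundary_boundary]; exact zero_mem _) h
  rw [boundary_boundary] at h'
  exact h'.eq (represents_zero i)

/-- The part of `𝓓(L_M)` supported on the divisors of `α` is exact in positive degrees. -/
theorem IsBettiGraded.exists_phi_eq (H : IsBettiGraded k m) {α : Fin n →₀ ℕ} {q : ℕ}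
    {x : PosetSpace m k (q + 1)}
    (hx : ∀ β : lcmLattice' m, ¬β.1 ≤ α → projectionAt m k β q x = 0) (h0 : phi m k q x = 0) :
    ∃ y : PosetSpace m k (q + 2),
      (∀ β : lcmLattice' m, ¬β.1 ≤ α → projectionAt m k β (q + 1) y = 0) ∧
      phi m k (q + 1) y = x := by
  obtain ⟨c, hc, hd, h1, h2⟩ := H.exists_cell hx
  rw [h0] at h2
  -- Subtracting `b` turns the representing chain into a cycle without changing its class, since `b`
  -- lies in the lower stage.
  obtain ⟨b, hb, hbc⟩ : ∃ b ∈ chains k (supComplex m (stage k m q α)) (q + 1),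
      boundary k b = boundary k c := by
    cases q with
    | zero =>
      obtain ⟨e, he, hec⟩ := HasClass.exists_boundary h2
      have he0 : e = 0 := by
        ext A
        by_contra hA
        obtain ⟨h3, h4⟩ := he A hA
        obtain ⟨B, rfl, hB⟩ := mem_lowerClosure.1 h3
        rw [Finset.subset_empty.1 hB] at h4
        exact absurd h4 (by simp)
      exact ⟨0, zero_mem _, by rw [← hec, he0]⟩
    | succ p =>
      obtain ⟨w, hw, e, he, h⟩ := H.exists_of_represents_zero hd
        (by rw [boundary_boundary]; exact zero_mem _) h2
      have hde : boundary k e = 0 := by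
        have h3 := boundary_boundary k c
        rwa [h, map_add, boundary_boundary, zero_add] at h3
      -- Stage `p` has no Betti element of degree `p + 1`, so relative to the void complex the cycle
      -- `e` is itself a boundary.
      obtain ⟨e', he', f, hf, hef⟩ := exists_boundary_add (Z := ⊥) H.ne_zero bot_le
        (fun γ hγ _ => H.not_isBetti_of_mem_stage p.lt_succ_self hγ) he
        (by rw [hde]; exact fun A hA => absurd rfl hA)
      have hf0 : f = 0 := by
        ext A
        by_contra hA
        exact (hf A hA).1
      refine ⟨w + e', add_mem hw (chains_mono (supComplex_mono (stage_mono p.le_succ α)) _ he'), ?_⟩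
      rw [map_add, h, hef, hf0, add_zero]
  have hcb : c - b ∈ chains k (supComplex m (stage k m (q + 1) α)) (q + 1) :=
    sub_mem hc (chains_mono (supComplex_mono (stage_mono q.le_succ α)) _ hb)
  have hdcb : boundary k (c - b) = 0 := by rw [map_sub, hbc, sub_self]
  have h3 : Represents (q + 1) (c - b) x := by
    rw [← sub_zero x]
    exact h1.sub (H.represents_zero_of_mem_stage hb)
  -- The cycle bounds in the simplex on the generators dividing `α`; if there are none, it has no
  -- faces and is zero.
  obtain ⟨g, hg, hgc⟩ : ∃ g ∈ chains k (supComplex m (LowerSet.Iic α)) (q + 2),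
      boundary k g = c - b := by
    have h4 := chains_mono (supComplex_mono (stage_le_Iic _ _)) _ hcb
    by_cases hα : ∃ i, m i ≤ α
    · obtain ⟨i, hi⟩ := hα
      exact exists_boundary_eq_of_cycle hi h4 hdcb
    · refine ⟨0, zero_mem _, ?_⟩
      rw [map_zero]
      ext A
      by_contra hA
      obtain ⟨h5, h6⟩ := h4 A (Ne.symm hA)
      obtain ⟨i, hi⟩ : A.Nonempty := Finset.card_pos.1 (by omega)
      exact hα ⟨i, (Finset.le_sup hi).trans h5⟩
  have hle : supComplex m (stage k m (q + 1) α) ≤ supComplex m (stage k m (q + 2) α) :=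
    supComplex_mono (stage_mono (q + 1).le_succ α)
  -- The filling can be pushed into stage `q + 2`, which contains every Betti element of that degree
  -- dividing `α`. The element it represents is the required preimage.
  obtain ⟨w, -, g', hg', h4⟩ := exists_boundary_add H.ne_zero
    (stage_le_Iic (k := k) (m := m) (q + 2) α)
    (fun γ hγ hγ' hB => hγ' (hB.mem_stage le_rfl hγ)) hg
    (by rw [hgc]; exact fun A hA => hle (hcb A hA).1)
  have hg'c : boundary k g' = c - b := by
    rw [← hgc, h4, map_add, boundary_boundary, zero_add]
  have hdg' : boundary k g' ∈ chains k (supComplex m (stage k m (q + 1) α)) (q + 1) :=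
    hg'c ▸ hcb
  obtain ⟨y, hy, hyα⟩ := H.exists_represents hg' hdg'
  refine ⟨y, hyα, ?_⟩
  have h5 := H.represents_phi hg' hdg' hy
  rw [hg'c] at h5
  exact h5.eq h3

end Cells

/-! ### Homogenized matrices -/

section Matrices

variable {k : Type u} [Field k] {n : ℕ} {I J K : Type*} [Fintype J]
  {degI : I → (Fin n →₀ ℕ)} {degJ : J → (Fin n →₀ ℕ)}
  {degK : K → (Fin n →₀ ℕ)}
  {a : J → I → k} {b : K → J → k}

/-- Along a nonzero product of scalars the monomial quotients telescope to one that does not depend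
on `v`. -/
theorem homogenized_mul_eq_zero (ha : ∀ v u, a v u ≠ 0 → degI u ≤ degJ v)
    (hb : ∀ w v, b w v ≠ 0 → degJ v ≤ degK w) (hab : ∀ w u, ∑ v, b w v * a v u = 0) (w : K)
    (u : I) :
    ∑ v, MvPolynomial.monomial (degK w - degJ v) (b w v) *
      MvPolynomial.monomial (degJ v - degI u) (a v u) = 0 := by
  have h : ∀ v, MvPolynomial.monomial (degK w - degJ v) (b w v) *
      MvPolynomial.monomial (degJ v - degI u) (a v u) =
        MvPolynomial.monomial (degK w - degI u) (b w v * a v u) := by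
    intro v
    rw [MvPolynomial.monomial_mul]
    by_cases h0 : b w v * a v u = 0
    · rw [h0, map_zero, map_zero]
    · rw [tsub_add_tsub_cancel (hb w v (left_ne_zero_of_mul h0)) (ha v u (right_ne_zero_of_mul h0))]
  rw [Finset.sum_congr rfl fun v _ => h v, ← map_sum, hab, map_zero]

/-- If all the strands of a pair of homogenized matrices are exact, then so is the pair. -/
theorem exists_of_homogenized_eq_zero [Fintype K] (ha : ∀ v u, a v u ≠ 0 → degI u ≤ degJ v)
    (hb : ∀ w v, b w v ≠ 0 → degJ v ≤ degK w)
    (H : ∀ (α : Fin n →₀ ℕ) (t : J → k), (∀ v, ¬degJ v ≤ α → t v = 0) →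
      (∀ u, ∑ v, t v * a v u = 0) →
      ∃ y : K → k, (∀ w, ¬degK w ≤ α → y w = 0) ∧ ∀ v, ∑ w, y w * b w v = t v)
    {x : J → MvPolynomial (Fin n) k}
    (hx : ∀ u, ∑ v, x v * MvPolynomial.monomial (degJ v - degI u) (a v u) = 0) :
    ∃ y : K → MvPolynomial (Fin n) k,
      ∀ v, ∑ w, y w * MvPolynomial.monomial (degK w - degJ v) (b w v) = x v := by
  classical
  -- The multidegree-`α` part of `x`, as scalar coordinates in the strand at `α`.
  let t : (Fin n →₀ ℕ) → J → k := fun α v =>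
    if degJ v ≤ α then (x v).coeff (α - degJ v) else 0
  have ht : ∀ α u, ∑ v, t α v * a v u = 0 := by
    intro α u
    by_cases hu : degI u ≤ α
    · have h := congrArg (MvPolynomial.coeff (α - degI u)) (hx u)
      rw [MvPolynomial.coeff_sum, MvPolynomial.coeff_zero] at h
      rw [← h]
      refine Finset.sum_congr rfl fun v _ => ?_
      by_cases h0 : a v u = 0
      · rw [h0, map_zero, mul_zero, mul_zero, MvPolynomial.coeff_zero]
      · have hle := ha v u h0
        rw [MvPolynomial.coeff_mul_monomial']
        by_cases hv : degJ v ≤ α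
        · rw [if_pos (tsub_le_tsub_right hv _), tsub_tsub_tsub_cancel_right hle]
          simp only [t, if_pos hv]
        · rw [if_neg fun h' => hv ?_]
          · simp only [t, if_neg hv, zero_mul]
          · have h2 := add_le_add_left h' (degI u)
            rwa [tsub_add_cancel_of_le hle, tsub_add_cancel_of_le hu] at h2
    · refine Finset.sum_eq_zero fun v _ => ?_
      by_cases h0 : a v u = 0
      · rw [h0, mul_zero]
      · simp only [t, if_neg fun h => hu ((ha v u h0).trans h), zero_mul]
  have key := fun α => H α (t α) (fun v hv => if_neg hv) (ht α)
  choose y hyα hy using key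
  -- The multidegrees in which `x` has a nonzero part; the strand solutions are reassembled over
  -- these.
  let T : Finset (Fin n →₀ ℕ) :=
    Finset.univ.biUnion fun v => (x v).support.image fun γ => γ + degJ v
  refine ⟨fun w => ∑ α ∈ T, MvPolynomial.monomial (α - degK w) (y α w), fun v => ?_⟩
  have h1 : ∀ w, (∑ α ∈ T, MvPolynomial.monomial (α - degK w) (y α w)) *
      MvPolynomial.monomial (degK w - degJ v) (b w v) =
        ∑ α ∈ T, MvPolynomial.monomial (α - degJ v) (y α w * b w v) := by
    intro w
    rw [Finset.sum_mul]
    refine Finset.sum_congr rfl fun α _ => ?_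
    rw [MvPolynomial.monomial_mul]
    by_cases h0 : y α w * b w v = 0
    · rw [h0, map_zero, map_zero]
    · have hw : degK w ≤ α := by
        by_contra h
        exact h0 (by rw [hyα α w h, zero_mul])
      rw [tsub_add_tsub_cancel hw (hb w v (right_ne_zero_of_mul h0))]
  rw [Finset.sum_congr rfl fun w _ => h1 w, Finset.sum_comm]
  have h2 : ∀ α ∈ T, ∑ w, MvPolynomial.monomial (α - degJ v) (y α w * b w v) =
      MvPolynomial.monomial (α - degJ v) (t α v) := fun α _ => by rw [← map_sum, hy]
  rw [Finset.sum_congr rfl h2]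
  ext γ
  rw [MvPolynomial.coeff_sum]
  have h3 : ∀ α, MvPolynomial.coeff γ (MvPolynomial.monomial (α - degJ v) (t α v)) =
      if α = γ + degJ v then (x v).coeff γ else 0 := by
    intro α
    rw [MvPolynomial.coeff_monomial]
    by_cases hα : α = γ + degJ v
    · subst hα
      simp [t]
    · rw [if_neg hα]
      split_ifs with h
      · simp only [t]
        refine if_neg fun hle => hα ?_
        rw [← h, tsub_add_cancel_of_le hle]
      · rfl
  rw [Finset.sum_congr rfl fun α _ => h3 α, Finset.sum_ite_eq' T]
  by_cases h0 : (x v).coeff γ = 0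
  · rw [h0, ite_self]
  · exact if_pos (Finset.mem_biUnion.2 ⟨v, Finset.mem_univ v,
      Finset.mem_image_of_mem _ (MvPolynomial.mem_support_iff.2 h0)⟩)

end Matrices

/-! ### Matrices of the poset construction and its homogenization -/

section Resolution

variable {k : Type u} [Field k] {n r : ℕ} {m : Fin r → (Fin n →₀ ℕ)} (b : HomologyBasis m k)

/-- The matrix entries of the maps of the poset construction. -/
def posetMatrix (i : ℕ) (v : PosetIndex m k (i + 1)) (u : PosetIndex m k i) : k :=
  (posetBasis b i).repr (phi m k i (posetBasis b (i + 1) v)) u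

theorem posetBasis_succ_repr (q : ℕ) (x : PosetSpace m k (q + 1)) (v : PosetIndex m k (q + 1)) :
    (posetBasis b (q + 1)).repr x v = (b.basis v.1 q).repr (projectionAt m k v.1 q x) v.2 :=
  rfl

theorem posetBasis_succ_apply (q : ℕ) (v : PosetIndex m k (q + 1)) :
    posetBasis b (q + 1) v = inclusionAt m k v.1 q (b.basis v.1 q v.2) := by
  refine (posetBasis b (q + 1)).repr.injective (Finsupp.ext fun u => ?_)
  rw [Module.Basis.repr_self, posetBasis_succ_repr]
  by_cases h : v.1 = u.1
  · obtain ⟨μ, x⟩ := v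
    obtain ⟨β, y⟩ := u
    obtain rfl : μ = β := h
    rw [projectionAt_inclusionAt_self, Module.Basis.repr_self]
    by_cases hxy : x = y
    · subst hxy
      exact Finsupp.single_eq_same.trans Finsupp.single_eq_same.symm
    · refine (Finsupp.single_eq_of_ne fun h => ?_).trans
        (Finsupp.single_eq_of_ne (Ne.symm hxy)).symm
      exact hxy (eq_of_heq (Sigma.mk.inj h).2).symm
  · rw [projectionAt_inclusionAt_of_ne h, map_zero, Finsupp.zero_apply, Finsupp.single_eq_of_ne]
    exact fun h' => h (congrArg Sigma.fst h').symm

/-- Components of `phi` only go to strictly smaller lattice elements. Strictness is what makes the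
resolution minimal. -/
theorem posetMdeg_lt_of_posetMatrix_ne_zero {i : ℕ} {v : PosetIndex m k (i + 1)}
    {u : PosetIndex m k i} (h : posetMatrix b i v u ≠ 0) :
    posetMdeg m k i u < posetMdeg m k (i + 1) v := by
  cases i with
  | zero => exact bot_lt_iff_ne_bot.2 (Finset.ne_of_mem_erase v.1.2)
  | succ q =>
    by_contra hlt
    replace hlt : ¬u.1.1 < v.1.1 := hlt
    refine h ?_
    rw [posetMatrix, posetBasis_succ_repr, posetBasis_succ_apply, projectionAt_phi_inclusionAt,
      phiComponent_eq_zero hlt, LinearMap.zero_apply, map_zero, Finsupp.zero_apply]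

theorem posetBasis_repr_phi (i : ℕ) (x : PosetSpace m k (i + 1)) (u : PosetIndex m k i) :
    (posetBasis b i).repr (phi m k i x) u =
      ∑ v, (posetBasis b (i + 1)).repr x v * posetMatrix b i v u := by
  conv_lhs => rw [← (posetBasis b (i + 1)).sum_repr x]
  simp only [map_sum, map_smul, Finsupp.coe_finsetSum, Finset.sum_apply, Finsupp.smul_apply,
    smul_eq_mul, posetMatrix]

/-- The basis of `S ⊗ 𝓓_i` induced by the basis of `𝓓_i`. -/
abbrev tensorBasis (i : ℕ) : Module.Basis (PosetIndex m k i) (MvPolynomial (Fin n) k)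
    (MvPolynomial (Fin n) k ⊗[k] PosetSpace m k i) :=
  Algebra.TensorProduct.basis (MvPolynomial (Fin n) k) (posetBasis b i)

theorem tensorBasis_repr_monomial_smul_baseChange {i j : ℕ} (a : Fin n →₀ ℕ)
    (f : PosetSpace m k j →ₗ[k] PosetSpace m k i) (v : PosetIndex m k j) (u : PosetIndex m k i) :
    (tensorBasis b i).repr ((MvPolynomial.monomial a (1 : k) •
      LinearMap.baseChange (MvPolynomial (Fin n) k) f) (tensorBasis b j v)) u =
        MvPolynomial.monomial a ((posetBasis b i).repr (f (posetBasis b j v)) u) := by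
  rw [LinearMap.smul_apply, map_smul, Algebra.TensorProduct.basis_apply,
    LinearMap.baseChange_tmul, Finsupp.smul_apply, Algebra.TensorProduct.basis_repr_tmul, one_smul,
    Finsupp.mapRange_apply, smul_eq_mul, MvPolynomial.algebraMap_eq, mul_comm,
    MvPolynomial.C_mul_monomial, mul_one]

theorem tensorBasis_repr_homogeneousPhi_self (i : ℕ) (v : PosetIndex m k (i + 1))
    (u : PosetIndex m k i) :
    (tensorBasis b i).repr
      (homogeneousPhi m k i (tensorBasis b (i + 1) v)) u =
      MvPolynomial.monomial (posetMdeg m k (i + 1) v - posetMdeg m k i u)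
        (posetMatrix b i v u) := by
  cases i with
  | zero =>
    refine (congrArg (fun x => (tensorBasis b 0).repr x u) (LinearMap.sum_apply _ _ _)).trans ?_
    rw [map_sum, Finsupp.finsetSum_apply]
    refine (Finset.sum_eq_single_of_mem v.1 (Finset.mem_univ v.1) fun μ _ hμ => ?_).trans ?_
    · refine (tensorBasis_repr_monomial_smul_baseChange b μ.1
        (phiOne m k μ.1 ∘ₗ projectionAt m k μ 0 : PosetSpace m k 1 →ₗ[k] PosetSpace m k 0)
        v u).trans ?_
      have h : (phiOne m k μ.1 ∘ₗ projectionAt m k μ 0 : PosetSpace m k 1 →ₗ[k] PosetSpace m k 0)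
          (posetBasis b 1 v) = 0 := by
        rw [posetBasis_succ_apply]
        refine (congrArg (phiOne m k μ.1) (projectionAt_inclusionAt_of_ne hμ.symm _ _)).trans ?_
        exact map_zero _
      rw [h, map_zero, Finsupp.zero_apply, map_zero]
    · refine (tensorBasis_repr_monomial_smul_baseChange b v.1.1
        (phiOne m k v.1.1 ∘ₗ projectionAt m k v.1 0 : PosetSpace m k 1 →ₗ[k] PosetSpace m k 0)
        v u).trans ?_
      have h : (phiOne m k v.1.1 ∘ₗ projectionAt m k v.1 0 :
          PosetSpace m k 1 →ₗ[k] PosetSpace m k 0) (posetBasis b 1 v) =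
            phi m k 0 (posetBasis b 1 v) := by
        rw [posetBasis_succ_apply, phi_zero_inclusionAt]
        exact congrArg (phiOne m k v.1.1) (projectionAt_inclusionAt_self _ _ _)
      rw [h, posetMatrix]
      exact congrArg (fun a => MvPolynomial.monomial a _) (tsub_zero v.1.1).symm
  | succ q =>
    have hterm : ∀ μ β : lcmLattice' m, (tensorBasis b (q + 1)).repr
        ((MvPolynomial.monomial (μ.1 - β.1) (1 : k) •
          LinearMap.baseChange (MvPolynomial (Fin n) k)
            (inclusionAt m k β q ∘ₗ phiComponent m k μ.1 β.1 q ∘ₗ projectionAt m k μ (q + 1)))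
          (tensorBasis b (q + 2) v)) u = MvPolynomial.monomial (μ.1 - β.1)
            ((b.basis u.1 q).repr (projectionAt m k u.1 q (inclusionAt m k β q
              (phiComponent m k μ.1 β.1 q (projectionAt m k μ (q + 1)
                (inclusionAt m k v.1 (q + 1) (b.basis v.1 (q + 1) v.2)))))) u.2) := fun μ β => by
      rw [tensorBasis_repr_monomial_smul_baseChange, posetBasis_succ_repr, posetBasis_succ_apply]
      rfl
    rw [homogeneousPhi]
    simp only [LinearMap.sum_apply, map_sum, Finsupp.finsetSum_apply]
    refine (Finset.sum_congr rfl fun μ _ => Finset.sum_congr rfl fun β _ => hterm μ β).trans ?_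
    rw [Finset.sum_eq_single_of_mem v.1 (Finset.mem_univ v.1),
      Finset.sum_eq_single_of_mem u.1 (Finset.mem_univ u.1), projectionAt_inclusionAt_self,
      projectionAt_inclusionAt_self, posetMatrix, posetBasis_succ_repr, posetBasis_succ_apply,
      projectionAt_phi_inclusionAt]
    · rfl
    · intro β _ hβ
      rw [projectionAt_inclusionAt_of_ne hβ, map_zero, Finsupp.zero_apply, map_zero]
    · intro μ _ hμ
      refine Finset.sum_eq_zero fun β _ => ?_
      rw [projectionAt_inclusionAt_of_ne hμ.symm, map_zero, map_zero, map_zero, map_zero,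
        Finsupp.zero_apply, map_zero]

theorem tensorBasis_repr_homogeneousPhi (i : ℕ)
    (x : MvPolynomial (Fin n) k ⊗[k] PosetSpace m k (i + 1))
    (u : PosetIndex m k i) :
    (tensorBasis b i).repr (homogeneousPhi m k i x) u =
      ∑ v, (tensorBasis b (i + 1)).repr x v *
        MvPolynomial.monomial (posetMdeg m k (i + 1) v - posetMdeg m k i u)
          (posetMatrix b i v u) := by
  conv_lhs => rw [← (tensorBasis b (i + 1)).sum_repr x]
  rw [map_sum, map_sum, Finsupp.finsetSum_apply]
  refine Finset.sum_congr rfl fun v _ => ?_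
  rw [map_smul, map_smul, Finsupp.smul_apply, tensorBasis_repr_homogeneousPhi_self, smul_eq_mul]

theorem projectionAt_eq_zero_iff {q : ℕ} {α : Fin n →₀ ℕ} (x : PosetSpace m k (q + 1)) :
    (∀ β : lcmLattice' m, ¬β.1 ≤ α → projectionAt m k β q x = 0) ↔
      ∀ v : PosetIndex m k (q + 1), ¬posetMdeg m k (q + 1) v ≤ α →
        (posetBasis b (q + 1)).repr x v = 0 := by
  constructor
  · intro h v hv
    rw [posetBasis_succ_repr, h v.1 hv, map_zero, Finsupp.zero_apply]
  · intro h β hβ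
    refine (b.basis β q).repr.injective (Finsupp.ext fun y => ?_)
    rw [map_zero]
    exact h ⟨β, y⟩ hβ

theorem IsBettiGraded.sum_posetMatrix_mul (H : IsBettiGraded k m) (i : ℕ)
    (w : PosetIndex m k (i + 2)) (u : PosetIndex m k i) :
    ∑ v, posetMatrix b (i + 1) w v * posetMatrix b i v u = 0 := by
  have h := posetBasis_repr_phi b i (phi m k (i + 1) (posetBasis b (i + 2) w)) u
  rw [H.phi_phi, map_zero, Finsupp.zero_apply] at h
  exact h.symm

theorem IsBettiGraded.exact (b : HomologyBasis m k) (H : IsBettiGraded k m) (i : ℕ) :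
    Function.Exact (homogeneousPhi m k (i + 1)) (homogeneousPhi m k i) := by
  have hle : ∀ i, ∀ (v : PosetIndex m k (i + 1)) (u : PosetIndex m k i), posetMatrix b i v u ≠ 0 →
      posetMdeg m k i u ≤ posetMdeg m k (i + 1) v := fun i v u h =>
    (posetMdeg_lt_of_posetMatrix_ne_zero b h).le
  intro x
  constructor
  · intro hx
    -- In scalar coordinates, this is exactness of the part of the construction supported on
    -- divisors of `α`.
    have strands : ∀ (α : Fin n →₀ ℕ) (t : PosetIndex m k (i + 1) → k),
        (∀ v, ¬posetMdeg m k (i + 1) v ≤ α → t v = 0) →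
        (∀ u, ∑ v, t v * posetMatrix b i v u = 0) →
        ∃ y : PosetIndex m k (i + 2) → k, (∀ w, ¬posetMdeg m k (i + 2) w ≤ α → y w = 0) ∧
          ∀ v, ∑ w, y w * posetMatrix b (i + 1) w v = t v := by
      intro α t ht h0
      set x' : PosetSpace m k (i + 1) := ∑ v, t v • posetBasis b (i + 1) v with hx'
      have hr : ∀ v, (posetBasis b (i + 1)).repr x' v = t v := fun v => by
        rw [hx', (posetBasis b (i + 1)).repr_sum_self]
      obtain ⟨y, hy1, hy2⟩ := H.exists_phi_eq (α := α) (x := x')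
        ((projectionAt_eq_zero_iff b x').2 fun v hv => (hr v).trans (ht v hv)) (by
          refine (posetBasis b i).repr.injective (Finsupp.ext fun u => ?_)
          rw [posetBasis_repr_phi, map_zero, Finsupp.zero_apply, ← h0 u]
          exact Finset.sum_congr rfl fun v _ => by rw [hr])
      refine ⟨fun w => (posetBasis b (i + 2)).repr y w,
        (projectionAt_eq_zero_iff b y).1 hy1, fun v => ?_⟩
      rw [← posetBasis_repr_phi, hy2, hr]
    obtain ⟨y, hy⟩ := exists_of_homogenized_eq_zero (hle i) (hle (i + 1)) strands
      (x := fun v => (tensorBasis b (i + 1)).repr x v) fun u => by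
        rw [← tensorBasis_repr_homogeneousPhi, hx, map_zero, Finsupp.zero_apply]
    refine ⟨∑ w : PosetIndex m k (i + 2), y w • tensorBasis b (i + 2) w, ?_⟩
    refine (tensorBasis b (i + 1)).repr.injective (Finsupp.ext fun v => ?_)
    rw [tensorBasis_repr_homogeneousPhi, ← hy]
    exact Finset.sum_congr rfl fun w _ => by
      rw [(tensorBasis b (i + 2)).repr_sum_self]
  · rintro ⟨y, rfl⟩
    refine (tensorBasis b i).repr.injective (Finsupp.ext fun u => ?_)
    rw [map_zero, Finsupp.zero_apply, tensorBasis_repr_homogeneousPhi]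
    have h1 : ∀ v : PosetIndex m k (i + 1),
        (tensorBasis b (i + 1)).repr (homogeneousPhi m k (i + 1) y) v *
        MvPolynomial.monomial (posetMdeg m k (i + 1) v - posetMdeg m k i u)
          (posetMatrix b i v u) = ∑ w : PosetIndex m k (i + 2),
            (tensorBasis b (i + 2)).repr y w *
            (MvPolynomial.monomial (posetMdeg m k (i + 2) w - posetMdeg m k (i + 1) v)
              (posetMatrix b (i + 1) w v) *
            MvPolynomial.monomial (posetMdeg m k (i + 1) v - posetMdeg m k i u)
              (posetMatrix b i v u)) := fun v => by
      rw [tensorBasis_repr_homogeneousPhi, Finset.sum_mul]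
      exact Finset.sum_congr rfl fun w _ => mul_assoc _ _ _
    rw [Finset.sum_congr rfl fun v _ => h1 v, Finset.sum_comm]
    refine Finset.sum_eq_zero fun w _ => ?_
    rw [← Finset.mul_sum, homogenized_mul_eq_zero (hle i) (hle (i + 1))
      (H.sum_posetMatrix_mul b i), mul_zero]

-- If the lcm `γ` were a proper divisor of the multidegree `μ` of `v`, exactness at `γ` would give
-- `y` supported below `γ` with the same image as `v`. Then `v - y` is a cycle, so exactness at `μ`
-- writes it as `phi z` with `z` supported on divisors of `μ`. Only proper multiples of `μ` can
-- contribute to the component of `phi z` at `μ`, so this component is zero, whereas that of `v - y`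
-- is a basis element.
open Classical in
theorem IsBettiGraded.sup_posetMdeg (H : IsBettiGraded k m) (i : ℕ)
    (v : PosetIndex m k (i + 2)) :
    (Finset.univ.filter fun u => posetMatrix b (i + 1) v u ≠ 0).sup (posetMdeg m k (i + 1)) =
      posetMdeg m k (i + 2) v := by
  set γ := (Finset.univ.filter fun u => posetMatrix b (i + 1) v u ≠ 0).sup
    (posetMdeg m k (i + 1)) with hγ
  have hle : γ ≤ posetMdeg m k (i + 2) v := Finset.sup_le fun u hu =>
    (posetMdeg_lt_of_posetMatrix_ne_zero b (Finset.mem_filter.1 hu).2).le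
  by_contra hne
  have hlt : γ < v.1.1 := lt_of_le_of_ne hle hne
  have hx : ∀ β : lcmLattice' m, ¬β.1 ≤ γ →
      projectionAt m k β i (phi m k (i + 1) (posetBasis b (i + 2) v)) = 0 := by
    rw [projectionAt_eq_zero_iff b]
    intro u hu
    by_contra h
    exact hu (Finset.le_sup (f := posetMdeg m k (i + 1))
      (Finset.mem_filter.2 ⟨Finset.mem_univ u, h⟩))
  obtain ⟨y, hy, hyx⟩ := H.exists_phi_eq hx (H.phi_phi i _)
  obtain ⟨z, hz, hzx⟩ := H.exists_phi_eq (α := v.1.1) (x := posetBasis b (i + 2) v - y)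
    (fun β hβ => by
      rw [map_sub, hy β fun h => hβ (h.trans hlt.le), sub_zero, posetBasis_succ_apply]
      exact projectionAt_inclusionAt_of_ne (fun h => hβ (congrArg Subtype.val h).ge) _ _)
    (by rw [map_sub, hyx, sub_self])
  have h1 := congrArg (projectionAt m k v.1 (i + 1)) hzx
  rw [map_sub, hy v.1 hlt.not_ge, sub_zero, posetBasis_succ_apply, projectionAt_inclusionAt_self,
    projectionAt_phi, Finset.sum_eq_zero] at h1
  · exact (b.basis v.1 (i + 1)).ne_zero v.2 h1.symm
  · intro μ _
    by_cases hμ : μ.1 ≤ v.1.1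
    · rw [phiComponent_eq_zero hμ.not_gt, LinearMap.zero_apply]
    · rw [hz μ hμ, map_zero]

end Resolution

/-! ### The frame, its homogenization, and the resolution -/

section Frame

variable {k : Type u} [Field k] {n r : ℕ} {m : Fin r → (Fin n →₀ ℕ)}

theorem IsMinimallyGeneratedBy.ne_zero {M : Ideal (MvPolynomial (Fin n) k)}
    (hM : IsMinimallyGeneratedBy M m) (hM' : M ≠ ⊤) (i : Fin r) : m i ≠ 0 := by
  intro h
  refine hM' ((Ideal.eq_top_iff_one M).2 ?_)
  rw [← hM.span_eq]
  exact Ideal.subset_span ⟨i, by simp [h]⟩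

theorem Delta_generator (hm : ∀ i, m i ≠ 0) (hmin : ∀ i j, m i ≤ m j → i = j) (j : Fin r) :
    Delta m (m j) = pointComplex r := by
  ext A
  simp only [SetLike.mem_coe, mem_Delta_iff, mem_lowerClosure, Set.mem_singleton_iff,
    exists_eq_left, Finset.subset_empty]
  constructor
  · intro hA
    by_contra h0
    obtain ⟨i, hi⟩ := Finset.nonempty_iff_ne_empty.2 h0
    have hlt : m i < m j := (Finset.le_sup hi).trans_lt hA
    obtain rfl := hmin i j hlt.le
    exact lt_irrefl _ hlt
  · rintro rfl
    rw [Finset.sup_empty]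
    exact bot_lt_iff_ne_bot.2 (hm j)

theorem finrank_homology_of_eq_pointComplex {Δ : Complex r} (h : Δ = pointComplex r) :
    Module.finrank k (Homology k Δ 0) = 1 := by
  subst h
  rw [Module.finrank_eq_card_basis (pointBasis k r), Fintype.card_unit]

theorem generator_mem_lcmLattice' (hm : ∀ i, m i ≠ 0) (j : Fin r) : m j ∈ lcmLattice' m := by
  refine Finset.mem_erase.2 ⟨hm j, ?_⟩
  have h := sup_mem_lcmLattice m {j}
  rwa [Finset.sup_singleton] at h

theorem isBetti_of_posetIndex {q : ℕ} (b : HomologyBasis m k) (v : PosetIndex m k (q + 1)) :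
    IsBetti k m (q + 1) v.1.1 :=
  ⟨v.1.2, nontrivial_of_ne _ _ ((b.basis v.1 q).ne_zero v.2)⟩

/-- The basis elements of `𝓓_1` correspond to the generators. -/
def generatorEquiv (k : Type u) [Field k] (hm : ∀ i, m i ≠ 0) (hmin : ∀ i j, m i ≤ m j → i = j)
    (b : HomologyBasis m k) : Fin r ≃ PosetIndex m k 1 :=
  Equiv.ofBijective
    (fun j => (⟨⟨m j, generator_mem_lcmLattice' hm j⟩, ⟨0, by
      rw [finrank_homology_of_eq_pointComplex (Delta_generator hm hmin j)]
      exact one_pos⟩⟩ : PosetIndex m k 1)) <| by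
    constructor
    · intro i j h
      exact hmin i j (congrArg (fun v : PosetIndex m k 1 => v.1.1) h).le
    · rintro ⟨⟨μ, hμ⟩, x⟩
      have hΔ := (isBetti_of_posetIndex b ⟨⟨μ, hμ⟩, x⟩).Delta_eq_pointComplex
      obtain ⟨i, hi⟩ := exists_le_of_mem_lcmLattice (Finset.mem_of_mem_erase hμ)
        (Finset.ne_of_mem_erase hμ)
      -- Otherwise the vertex `i` would be a face of `Delta m μ`, which is `{∅}`.
      obtain rfl : m i = μ := by
        by_contra hne
        have h : {i} ∈ Delta m μ := mem_Delta_iff.2 (by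
          rw [Finset.sup_singleton]
          exact lt_of_le_of_ne hi hne)
        change Delta m μ = pointComplex r at hΔ
        rw [hΔ] at h
        obtain ⟨B, rfl, hB⟩ := mem_lowerClosure.1 h
        exact Finset.singleton_ne_empty i (Finset.subset_empty.1 hB)
      refine ⟨i, ?_⟩
      have hx := Nat.lt_one_iff.1
        (x.2.trans_eq (finrank_homology_of_eq_pointComplex (Delta_generator hm hmin i)))
      exact congrArg (fun y => (⟨⟨m i, hμ⟩, y⟩ : PosetIndex m k 1)) (Fin.ext hx.symm)

/-- The normalization of the bases in dimension `-1` to the class of the empty face makes every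
entry of the first map equal to `1`. -/
theorem phi_zero_posetBasis (b : HomologyBasis m k) (v : PosetIndex m k 1) :
    phi m k 0 (posetBasis b 1 v) = pointBasis k r () := by
  have hv := isBetti_of_posetIndex b v
  rw [posetBasis_succ_apply, phi_zero_inclusionAt, phiOne, dif_pos hv.Delta_eq_pointComplex,
    b.basis_zero]
  have h : HasClass (Delta m v.1.1) 0 (Pi.single ∅ 1)
      (emptyClass k (Delta m v.1.1) (empty_mem_Delta m v.1)) := ⟨_, rfl⟩
  have h' : HasClass (pointComplex r) 0 (Pi.single ∅ 1) (pointBasis k r ()) := by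
    rw [pointBasis, Module.Basis.mk_apply]
    exact ⟨_, rfl⟩
  exact (h.map _).eq h'

theorem posetMatrix_zero (b : HomologyBasis m k) (v : PosetIndex m k 1) (u : PosetIndex m k 0) :
    posetMatrix b 0 v u = 1 := by
  rw [posetMatrix, phi_zero_posetBasis]
  exact (congrArg (fun x : Unit →₀ k => x ()) ((pointBasis k r).repr_self ())).trans
    Finsupp.single_eq_same

theorem isEmpty_posetIndex (b : HomologyBasis m k) {i : ℕ} (hi : r + 2 ≤ i) :
    IsEmpty (PosetIndex m k i) := by
  -- Here `q ≥ r + 1`, and a set of generators has at most `r` elements.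
  obtain ⟨q, rfl⟩ : ∃ q, i = q + 1 := ⟨i - 1, by omega⟩
  refine ⟨fun v => (b.basis v.1 q).ne_zero v.2 ?_⟩
  obtain ⟨z, hz⟩ := exists_hasClass ((b.basis v.1 q) v.2)
  have h0 : z = 0 := by
    ext A
    by_contra hA
    have h1 := (hz.1.1 A hA).2
    have h2 := Finset.card_le_univ A
    rw [Fintype.card_fin] at h2
    omega
  subst h0
  exact hz.eq ⟨zero_mem _, map_zero (homologyClass k _ q)⟩

theorem IsBettiGraded.isFrame (H : IsBettiGraded k m) (b : HomologyBasis m k)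
    (e : Fin r ≃ PosetIndex m k 1) : IsFrame (posetConstruction b) e where
  d_comp_d := H.phi_phi
  bounded := ⟨r + 2, fun _ hi => isEmpty_posetIndex b hi⟩
  degree_zero := ⟨(), fun _ => rfl, fun j => phi_zero_posetBasis b (e j)⟩

theorem IsBettiGraded.homogenizationMdeg_eq (H : IsBettiGraded k m) (b : HomologyBasis m k)
    (e : Fin r ≃ PosetIndex m k 1) (he : ∀ j, posetMdeg m k 1 (e j) = m j) :
    ∀ i, homogenizationMdeg m (posetConstruction b) e i = posetMdeg m k i
  | 0 => rfl
  | 1 => funext fun v => by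
      refine (he (e.symm v)).symm.trans ?_
      exact congrArg (posetMdeg m k 1) (e.apply_symm_apply v)
  | i + 2 => funext fun v => by
      refine Eq.trans ?_ (H.sup_posetMdeg b i v)
      exact congrArg (Finset.sup _) (H.homogenizationMdeg_eq b e he (i + 1))

theorem homogenization_d_single (m : Fin r → (Fin n →₀ ℕ)) (U : BasedSeq k) (e : Fin r ≃ U.I 1)
    (i : ℕ) (v : U.I (i + 1)) (u : U.I i) :
    (show U.I i →₀ MvPolynomial (Fin n) k from
      (homogenization m U e).d i (Finsupp.single v (1 : MvPolynomial (Fin n) k))) u =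
      MvPolynomial.monomial (homogenizationMdeg m U e (i + 1) v - homogenizationMdeg m U e i u)
        ((U.basis i).repr (U.d i (U.basis (i + 1) v)) u) := by
  classical
  refine (congrArg (fun x : U.I i →₀ MvPolynomial (Fin n) k => x u)
    ((Finsupp.linearCombination_single (M := U.I i →₀ MvPolynomial (Fin n) k)
      (MvPolynomial (Fin n) k) 1 v).trans (one_smul _ _))).trans ?_
  rw [Finsupp.finsetSum_apply, Finset.sum_eq_single_of_mem u (Finset.mem_univ u)]
  · exact Finsupp.single_eq_same
  · exact fun u' _ hu' => Finsupp.single_eq_of_ne hu'.symm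

theorem IsBettiGraded.equal_homogenization (H : IsBettiGraded k m) (b : HomologyBasis m k)
    (e : Fin r ≃ PosetIndex m k 1) (he : ∀ j, posetMdeg m k 1 (e j) = m j) :
    (posetResolution b).Equal (homogenization m (posetConstruction b) e) := by
  refine ⟨fun i => (tensorBasis b i).repr, fun i => Equiv.refl _, fun i v => ?_, fun i v => ?_,
    fun i x => ?_⟩
  · exact (tensorBasis b i).repr_self v
  · exact congrFun (H.homogenizationMdeg_eq b e he i) v
  · have h : (tensorBasis b i).repr.toLinearMap ∘ₗ homogeneousPhi m k i =
        (homogenization m (posetConstruction b) e).d i ∘ₗ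
          (tensorBasis b (i + 1)).repr.toLinearMap := by
      refine (tensorBasis b (i + 1)).ext fun v => Finsupp.ext fun u => ?_
      refine (tensorBasis_repr_homogeneousPhi_self b i v u).trans ?_
      symm
      refine (congrArg (fun x : PosetIndex m k (i + 1) →₀ MvPolynomial (Fin n) k =>
        (show PosetIndex m k i →₀ MvPolynomial (Fin n) k from
          (homogenization m (posetConstruction b) e).d i x) u)
        ((tensorBasis b (i + 1)).repr_self v)).trans ?_
      refine (homogenization_d_single m (posetConstruction b) e i v u).trans ?_
      rw [H.homogenizationMdeg_eq b e he, H.homogenizationMdeg_eq b e he]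
      rfl
    exact LinearMap.congr_fun h x

theorem monomial_mem_span_X {a : Fin n →₀ ℕ} (ha : a ≠ 0) (c : k) :
    MvPolynomial.monomial a c ∈
      (Ideal.span (Set.range MvPolynomial.X) : Ideal (MvPolynomial (Fin n) k)) := by
  obtain ⟨i, hi⟩ := Finsupp.ne_iff.1 ha
  have hle : Finsupp.single i 1 ≤ a :=
    Finsupp.single_le_iff.2 (Nat.one_le_iff_ne_zero.2 hi)
  have h : MvPolynomial.monomial a c =
      MvPolynomial.monomial (a - Finsupp.single i 1) c * MvPolynomial.X i := by
    rw [MvPolynomial.X, MvPolynomial.monomial_mul, mul_one, tsub_add_cancel_of_le hle]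
  rw [h]
  exact Ideal.mul_mem_left _ _ (Ideal.subset_span ⟨i, rfl⟩)

theorem homogeneousPhi_mem (b : HomologyBasis m k) (i : ℕ)
    (x : MvPolynomial (Fin n) k ⊗[k] PosetSpace m k (i + 1)) :
    homogeneousPhi m k i x ∈
      (Ideal.span (Set.range MvPolynomial.X) : Ideal (MvPolynomial (Fin n) k)) •
        (⊤ : Submodule (MvPolynomial (Fin n) k)
          (MvPolynomial (Fin n) k ⊗[k] PosetSpace m k i)) := by
  rw [← (tensorBasis b i).sum_repr (homogeneousPhi m k i x)]
  refine sum_mem fun u _ => Submodule.smul_mem_smul ?_ Submodule.mem_top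
  rw [tensorBasis_repr_homogeneousPhi]
  refine sum_mem fun v _ => Ideal.mul_mem_left _ _ ?_
  by_cases h0 : posetMatrix b i v u = 0
  · rw [h0, map_zero]
    exact zero_mem _
  · exact monomial_mem_span_X
      (tsub_pos_of_lt (posetMdeg_lt_of_posetMatrix_ne_zero b h0)).ne' _

/-- The single coordinate identifies the degree-zero module with the polynomial ring, and under it
the first differential has as image the ideal generated by the monomials. -/
theorem exists_augmentation {M : Ideal (MvPolynomial (Fin n) k)}
    (hM : IsMinimallyGeneratedBy M m) (b : HomologyBasis m k) (e : Fin r ≃ PosetIndex m k 1)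
    (he : ∀ j, posetMdeg m k 1 (e j) = m j) :
    ∃ ε : MvPolynomial (Fin n) k ⊗[k] PosetSpace m k 0 →ₗ[MvPolynomial (Fin n) k]
        MvPolynomial (Fin n) k ⧸ M,
      Function.Surjective ε ∧ Function.Exact (homogeneousPhi m k 0) ε ∧
      ∀ u, ε (tensorBasis b 0 u) = Ideal.Quotient.mk M (MvPolynomial.monomial 0 1) := by
  let o : PosetIndex m k 0 := ()
  let f : (MvPolynomial (Fin n) k ⊗[k] PosetSpace m k 0) →ₗ[MvPolynomial (Fin n) k]
      MvPolynomial (Fin n) k := (tensorBasis b 0).coord o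
  have hfd : ∀ x, f (homogeneousPhi m k 0 x) =
      ∑ j, (tensorBasis b 1).repr x (e j) * MvPolynomial.monomial (m j) 1 := by
    intro x
    refine (tensorBasis_repr_homogeneousPhi b 0 x o).trans ?_
    rw [← e.sum_comp]
    refine Finset.sum_congr rfl fun j _ => ?_
    rw [posetMatrix_zero, he]
    exact congrArg (fun a => _ * MvPolynomial.monomial a 1) (tsub_zero (m j))
  have hf1 : ∀ u, f (tensorBasis b 0 u) = 1 := fun u =>
    (congrArg (fun x : Unit →₀ MvPolynomial (Fin n) k => x ())
      ((tensorBasis b 0).repr_self u)).trans Finsupp.single_eq_same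
  refine ⟨Submodule.mkQ M ∘ₗ f, ?_, ?_, ?_⟩
  · intro y
    obtain ⟨p, rfl⟩ := Submodule.mkQ_surjective M y
    refine ⟨p • tensorBasis b 0 o, ?_⟩
    rw [LinearMap.comp_apply, map_smul, hf1, smul_eq_mul, mul_one]
  · intro y
    rw [LinearMap.comp_apply, Submodule.mkQ_apply, Submodule.Quotient.mk_eq_zero]
    constructor
    · intro hy
      rw [← hM.span_eq] at hy
      obtain ⟨c, hc⟩ := Submodule.mem_span_range_iff_exists_fun _ |>.1 hy
      refine ⟨∑ v : PosetIndex m k 1, c (e.symm v) • tensorBasis b 1 v, ?_⟩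
      refine (tensorBasis b 0).repr.injective (Finsupp.ext fun u => ?_)
      refine (hfd _).trans (Eq.trans ?_ hc)
      refine Finset.sum_congr rfl fun j _ => ?_
      rw [(tensorBasis b 1).repr_sum_self, e.symm_apply_apply, smul_eq_mul]
    · rintro ⟨x, rfl⟩
      rw [hfd, ← hM.span_eq]
      exact sum_mem fun j _ => Ideal.mul_mem_left _ _ (Ideal.subset_span ⟨j, rfl⟩)
  · intro u
    rw [LinearMap.comp_apply, hf1]
    rfl

theorem IsBettiGraded.isMinimalFreeResolution (H : IsBettiGraded k m)
    {M : Ideal (MvPolynomial (Fin n) k)}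
    (hM : IsMinimallyGeneratedBy M m) (b : HomologyBasis m k) (e : Fin r ≃ PosetIndex m k 1)
    (he : ∀ j, posetMdeg m k 1 (e j) = m j) :
    (posetResolution b).IsMinimalFreeResolution M where
  bounded := ⟨r + 2, fun _ hi => isEmpty_posetIndex b hi⟩
  isMultigraded i v u := by
    by_cases h0 : posetMatrix b i v u = 0
    · left
      refine (tensorBasis_repr_homogeneousPhi_self b i v u).trans ?_
      rw [h0, map_zero]
    · right
      exact ⟨_, _, add_tsub_cancel_of_le (posetMdeg_lt_of_posetMatrix_ne_zero b h0).le,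
        tensorBasis_repr_homogeneousPhi_self b i v u⟩
  exact i := H.exact b i
  augmentation := by
    obtain ⟨ε, h1, h2, h3⟩ := exists_augmentation hM b e he
    exact ⟨ε, h1, h2, fun u => ⟨1, h3 u⟩⟩
  minimal i := by
    rintro _ ⟨x, rfl⟩
    exact homogeneousPhi_mem b i x

end Frame

end MonomialResolution
end

theorem mainTheorem10 {k : Type*} [Field k] {n r : ℕ} (M : Ideal (MvPolynomial (Fin n) k))
    (m : Fin r → (Fin n →₀ ℕ)) (hM : MonomialResolution.IsMinimallyGeneratedBy M m) (hM' : M ≠ ⊤)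
    (hrigid : MonomialResolution.IsRigid m k) (b : MonomialResolution.HomologyBasis m k) :
    ∃ e : Fin r ≃ (MonomialResolution.posetConstruction b).I 1,
      (∀ j, (MonomialResolution.posetResolution b).mdeg 1 (e j) = m j) ∧
      MonomialResolution.IsFrame (MonomialResolution.posetConstruction b) e ∧
      (MonomialResolution.posetResolution b).Equal
        (MonomialResolution.homogenization m (MonomialResolution.posetConstruction b) e) ∧
      (MonomialResolution.posetResolution b).IsMinimalFreeResolution M := by
  have hm := hM.ne_zero hM'
  have H := hrigid.isBettiGraded hm
  let e := MonomialResolution.generatorEquiv k hm hM.minimal b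
  have he : ∀ j, MonomialResolution.posetMdeg m k 1 (e j) = m j := fun _ => rfl
  exact ⟨e, he, H.isFrame b e, H.equal_homogenization b e he,
    H.isMinimalFreeResolution hM b e he⟩
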